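/- Let $\mathbb K=\mathbb R$ or $\mathbb C$, and let $E$ and $F$ be nonzero $\mathbb K$-normed spaces (not necessarily complete). For a topological space $X$ let $C(X,E)$ be the space of continuous functions $X\to E$ and $C_b(X,E)$ the subspace of bounded ones; for a metric space $X$ let $C_b^u(X,E)$ be the space of bounded uniformly continuous functions $X\to E$. For $f\in C(X,E)$ put $c(f)=\{x\in X: f(x)\neq 0\}$. For subspaces $A(X,E)\subset C(X,E)$ and $A(Y,F)\subset C(Y,F)$, a map $T:A(X,E)\to A(Y,F)$ is *separating* if it is additive and $c(Tf)\cap c(Tg)=\emptyset$ whenever $c(f)\cap c(g)=\emptyset$, and *biseparating* if it is bijective and both $T$ and $T^{-1}$ are separating. A completely regular Hausdorff space $X$ is *realcompact* if every maximal ideal $M$ of $C(X,\mathbb R)$ for which the canonical map $\mathbb R\to C(X,\mathbb R)/M$ is onto has a common zero, that is, there is $x\in X$ with $f(x)=0$ for all $f\in M$. **Theorem.** Suppose that we are in one of the following situations. 1. $X$ and $Y$ are completely regular Hausdorff realcompact spaces, $A(X,E)=C(X,E)$ and $A(Y,F)=C(Y,F)$. 2. $X$ and $Y$ are completely regular Hausdorff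 realcompact spaces, $E$ and $F$ are infinite-dimensional, $A(X,E)=C_b(X,E)$ and $A(Y,F)=C_b(Y,F)$. 3. $X$ and $Y$ are complete metric spaces, $A(X,E)=C_b^u(X,E)$ and $A(Y,F)=C_b^u(Y,F)$. Let $T:A(X,E)\to A(Y,F)$ be a $\mathbb K$-linear biseparating map. Then there are a homeomorphism $h$ of $Y$ onto $X$ and a map $J$ from $Y$ into the set $B'(E,F)$ of (not necessarily continuous) bijective $\mathbb K$-linear maps from $E$ onto $F$ such that $$(Tf)(y)=(Jy)(f(h(y)))\qquad\text{for all } f\in A(X,E),\ y\in Y.$$ In situation 3, moreover, $h$ can be taken to be such that both $h$ and $h^{-1}$ are uniformly continuous. -/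

import Mathlib

universe u₁ u₂ u₃ u₄ u₅

/-- A (completely regular Hausdorff) space `X` is realcompact if every real maximal ideal of the
ring `C(X, ℝ)` is fixed. A maximal ideal `M` is real if the canonical copy of `ℝ` is all of the
residue field `C(X, ℝ) ⧸ M`; it is fixed if its elements have a common zero. Complete regularity
and the Hausdorff axiom are required separately, through `T35Space`. -/
def IsRealcompact (X : Type u₁) [TopologicalSpace X] : Prop :=
  ∀ M : Ideal C(X, ℝ), M.IsMaximal →
    Function.Surjective (algebraMap ℝ (C(X, ℝ) ⧸ M)) → ∃ x : X, ∀ f ∈ M, f x = 0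

section Spaces

variable (𝕜 : Type u₁) [RCLike 𝕜] (X : Type u₂) (E : Type u₃)
  [NormedAddCommGroup E] [NormedSpace 𝕜 E]

/-- The space `C(X, E)` of all continuous functions, as a subspace of itself. -/
def contFun [TopologicalSpace X] : Submodule 𝕜 C(X, E) := ⊤

/-- The space `C_b(X, E)` of bounded continuous functions. -/
def boundedContFun [TopologicalSpace X] : Submodule 𝕜 C(X, E) where
  carrier := {f | ∃ C : ℝ, ∀ x, ‖f x‖ ≤ C}
  zero_mem' := ⟨0, fun x => by simp⟩
  add_mem' := by
    rintro f g ⟨C, hC⟩ ⟨D, hD⟩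
    exact ⟨C + D, fun x => (norm_add_le (f x) (g x)).trans (add_le_add (hC x) (hD x))⟩
  smul_mem' := by
    rintro c f ⟨C, hC⟩
    refine ⟨‖c‖ * C, fun x => ?_⟩
    rw [ContinuousMap.smul_apply, norm_smul]
    exact mul_le_mul_of_nonneg_left (hC x) (norm_nonneg c)

/-- The space `C_b^u(X, E)` of bounded uniformly continuous functions. -/
def boundedUnifContFun [UniformSpace X] : Submodule 𝕜 C(X, E) where
  carrier := {f | (∃ C : ℝ, ∀ x, ‖f x‖ ≤ C) ∧ UniformContinuous f}
  zero_mem' := ⟨(boundedContFun 𝕜 X E).zero_mem, uniformContinuous_const⟩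
  add_mem' := by
    rintro f g ⟨hf, hf'⟩ ⟨hg, hg'⟩
    exact ⟨(boundedContFun 𝕜 X E).add_mem hf hg, hf'.add hg'⟩
  smul_mem' := by
    rintro c f ⟨hf, hf'⟩
    exact ⟨(boundedContFun 𝕜 X E).smul_mem c hf, hf'.const_smul c⟩

end Spaces

/-- The cozero set `c(f) = {x | f x ≠ 0}`. -/
def cozeroSet {X : Type u₁} {E : Type u₂} [TopologicalSpace X] [NormedAddCommGroup E]
    (f : C(X, E)) : Set X :=
  {x | f x ≠ 0}

section Separating

variable {𝕜 : Type u₁} [RCLike 𝕜] {X : Type u₂} {Y : Type u₃} {E : Type u₄} {F : Type u₅}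
  [TopologicalSpace X] [TopologicalSpace Y]
  [NormedAddCommGroup E] [NormedSpace 𝕜 E] [NormedAddCommGroup F] [NormedSpace 𝕜 F]
  {A : Submodule 𝕜 C(X, E)} {B : Submodule 𝕜 C(Y, F)}

/-- A map `T : A(X, E) → A(Y, F)` is separating if it is additive and sends functions with
disjoint cozero sets to functions with disjoint cozero sets. -/
def IsSeparating (T : A → B) : Prop :=
  (∀ f g : A, T (f + g) = T f + T g) ∧
    ∀ f g : A, cozeroSet f.1 ∩ cozeroSet g.1 = ∅ → cozeroSet (T f).1 ∩ cozeroSet (T g).1 = ∅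

/-- A map `T` is biseparating if it is bijective and both `T` and `T⁻¹` are separating. -/
def IsBiseparating (T : A → B) : Prop :=
  ∃ hT : Function.Bijective T,
    IsSeparating T ∧ IsSeparating (Equiv.ofBijective T hT).symm

end Separating

open Filter Topology

/-! ### Locality of disjointness-preserving maps, and disjoint sums -/

section Abstract

variable {𝕜 : Type*} [RCLike 𝕜] {X Y E F : Type*} [TopologicalSpace X] [TopologicalSpace Y]
  [NormedAddCommGroup E] [NormedSpace 𝕜 E] [NormedAddCommGroup F] [NormedSpace 𝕜 F]

/-! Linearity turns preservation of disjointness into locality: on the cozero set of `T f`, the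
values of `T g` depend only on `g` restricted to the cozero set of `f`. The representation follows
once every functional `f ↦ T f y` is concentrated at a single point `x` (`IsSupp`), and likewise for
the inverse. Locality gives `T f y = 0` when `f` vanishes near `x`; no continuity of `T` is
available to pass to `f x = 0`.

The substitute is a gliding-hump device. Cut `f` into dyadic shells, of `‖f‖` or of an auxiliary
positive function, and group them modulo 4 into four sums with disjoint cozero sets. If every piece
is killed at `y`, so is the sum, provided that only finitely many images are active near `y`
(`IsDisjSum.apply_eq_zero`). Accumulation at `y` is excluded by the continuity at `y` of one further
image. If the pieces weighted by `n` still sum to an element of the space, the image of that sum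
would blow up near `y` (`apply_eq_zero_of_weights`). If some element agrees on the pieces with
preimages of uniformly separated constants, its image would oscillate near `y`
(`apply_eq_zero_of_separated`). Weights serve for `‖f‖`-shells, as `n 2⁻ⁿ → 0`, and for `C(X, E)`,
where locally finite sums are free. Separated constants serve for `C_b`, which is where infinite
dimension enters.

Support points exist for two reasons. Over a realcompact space, the functions that are arbitrarily
small on carriers of the functional form a real maximal ideal (`IsRealcompact.exists_isSupp`). Over
a complete metric space, Efremovich's lemma makes the diameters of the carriers shrink to zero
(`exists_isSupp_of_completeSpace`). -/

/-- A subspace `A` of `C(X, E)` is admissible with respect to a set `S` of real functions if it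
contains the constants, is stable under multiplication by `S` and under uniform limits, and if `S`
contains bump functions and the bounded uniformly continuous functions of `‖f‖`, `f ∈ A`. -/
structure Admissible (S : Set (X → ℝ)) (A : Submodule 𝕜 C(X, E)) : Prop where
  const_mem : ∀ e : E, ContinuousMap.const X e ∈ A
  smul_mem : ∀ s ∈ S, ∀ f ∈ A, ∃ g ∈ A, ∀ x, g x = (s x : 𝕜) • f x
  comp_norm_mem : ∀ f ∈ A, ∀ θ : ℝ → ℝ, UniformContinuous θ → (∃ C, ∀ t, 0 ≤ t → |θ t| ≤ C) →
    (fun x => θ ‖f x‖) ∈ S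
  lim_mem : ∀ f : ℕ → C(X, E), (∀ n, f n ∈ A) → ∀ g : X → E,
    TendstoUniformly (fun n x => f n x) g atTop → ∃ g' ∈ A, ∀ x, g' x = g x
  bump : ∀ x, ∀ U ∈ 𝓝 x, ∃ s ∈ S, (∀ p, 0 ≤ s p ∧ s p ≤ 1) ∧ (∀ᶠ p in 𝓝 x, s p = 1) ∧
    ∀ p ∉ U, s p = 0

variable {S : Set (X → ℝ)} {S' : Set (Y → ℝ)}
  {A : Submodule 𝕜 C(X, E)} {B : Submodule 𝕜 C(Y, F)}

theorem Admissible.exists_const (hA : Admissible S A) (e : E) : ∃ g : A, ∀ x, g.1 x = e :=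
  ⟨⟨_, hA.const_mem e⟩, fun _ => rfl⟩

theorem Admissible.exists_smul (hA : Admissible S A) {s : X → ℝ} (hs : s ∈ S) (f : A) :
    ∃ g : A, ∀ x, g.1 x = (s x : 𝕜) • f.1 x := by
  obtain ⟨g, hg, h⟩ := hA.smul_mem s hs f.1 f.2
  exact ⟨⟨g, hg⟩, h⟩

/-- Two functions have disjoint cozero sets. -/
def DisjCoz (f g : C(X, E)) : Prop := ∀ x, f x = 0 ∨ g x = 0

/-- A linear bijection preserving disjointness of cozero sets in both directions. -/
def PresDisj (T : A ≃ₗ[𝕜] B) : Prop :=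
  ∀ f g : A, DisjCoz f.1 g.1 ↔ DisjCoz (T f).1 (T g).1

theorem PresDisj.symm {T : A ≃ₗ[𝕜] B} (hT : PresDisj T) : PresDisj T.symm := fun f g => by
  rw [hT]; simp

/-- `x` is a support point of the functional `f ↦ T f y`. -/
def IsSupp (T : A ≃ₗ[𝕜] B) (y : Y) (x : X) : Prop :=
  ∀ U ∈ 𝓝 x, ∃ f : A, (T f).1 y ≠ 0 ∧ ∀ p ∉ U, f.1 p = 0

theorem PresDisj.eq_zero {T : A ≃ₗ[𝕜] B} (hT : PresDisj T) {f g : A}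
    (h : ∀ x, f.1 x ≠ 0 → g.1 x = 0) {y : Y} (hy : (T f).1 y ≠ 0) : (T g).1 y = 0 :=
  (((hT f g).1 fun x => or_iff_not_imp_left.2 (h x)) y).resolve_left hy

theorem PresDisj.eq_of_eq {T : A ≃ₗ[𝕜] B} (hT : PresDisj T) {f g k : A}
    (h : ∀ x, f.1 x ≠ 0 → g.1 x = k.1 x) {y : Y} (hy : (T f).1 y ≠ 0) :
    (T g).1 y = (T k).1 y := by
  have := hT.eq_zero (f := f) (g := g - k) (fun x hx => by simp [h x hx]) hy
  simpa [sub_eq_zero] using this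

theorem IsSupp.eq_zero {T : A ≃ₗ[𝕜] B} (hT : PresDisj T) {y : Y} {x : X} (hx : IsSupp T y x)
    {f : A} (hf : ∀ᶠ p in 𝓝 x, f.1 p = 0) : (T f).1 y = 0 := by
  obtain ⟨g, hgy, hg⟩ := hx _ hf
  exact hT.eq_zero (f := g) (fun p hp => by by_contra h; exact hp (hg p h)) hgy

/-- If `T k y ≠ 0`, a bump times `T k` lives where `T l` vanishes. Its preimage is disjoint from
`l`, hence from `k`, although both images are nonzero at `y`. -/
theorem PresDisj.eq_zero_of_subset {T : A ≃ₗ[𝕜] B} (hT : PresDisj T) (hB : Admissible S' B)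
    {k l : A} (hkl : ∀ x, k.1 x ≠ 0 → l.1 x ≠ 0) {y : Y} (hl : ∀ᶠ z in 𝓝 y, (T l).1 z = 0) :
    (T k).1 y = 0 := by
  by_contra hk
  obtain ⟨s, hs, -, hs1, hs0⟩ := hB.bump y _ hl
  obtain ⟨m, hm⟩ := hB.exists_smul hs (T k)
  have hmy : m.1 y ≠ 0 := by
    rw [hm, hs1.self_of_nhds]; simpa using hk
  obtain ⟨m', rfl⟩ := T.surjective m
  have h1 : DisjCoz m'.1 l.1 := by
    rw [hT]
    intro z
    by_cases hz : (T l).1 z = 0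
    · exact Or.inr hz
    · left; rw [hm, hs0 z hz]; simp
  exact hk (hT.eq_zero (f := m') (fun x hx => by
    by_contra h
    exact hkl x h ((h1 x).resolve_left hx)) hmy)

/-- `s` is the pointwise sum of the functions `q n`, which have disjoint cozero sets. -/
structure IsDisjSum (q : ℕ → A) (s : A) : Prop where
  disj : ∀ n m x, (q n).1 x ≠ 0 → (q m).1 x ≠ 0 → n = m
  sum_eq : ∀ x, s.1 x = ∑ᶠ n, (q n).1 x

theorem IsDisjSum.eq {q : ℕ → A} {s : A} (h : IsDisjSum q s) {n : ℕ} {x : X}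
    (hx : (q n).1 x ≠ 0) : s.1 x = (q n).1 x := by
  rw [h.sum_eq]
  refine finsum_eq_single _ n fun m hm => ?_
  by_contra hmx
  exact hm (h.disj m n x hmx hx)

theorem IsDisjSum.exists_ne {q : ℕ → A} {s : A} (h : IsDisjSum q s) {x : X}
    (hx : s.1 x ≠ 0) : ∃ n, (q n).1 x ≠ 0 := by
  by_contra! h0
  exact hx (by simp [h.sum_eq, h0])

/-- The finitely many terms in `K` contribute nothing at `y`, so only the remainder `r` matters.
Localizing `T r` near `y` gives a function disjoint from every `T (q n)`; its preimage avoids every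
`q n`, hence avoids `r`. -/
theorem IsDisjSum.apply_eq_zero {T : A ≃ₗ[𝕜] B} (hT : PresDisj T) (hB : Admissible S' B)
    {q : ℕ → A} {s : A} (h : IsDisjSum q s) {y : Y} (K : Finset ℕ)
    (hK : ∀ᶠ z in 𝓝 y, ∀ n ∉ K, (T (q n)).1 z = 0) (hy : ∀ n, (T (q n)).1 y = 0) :
    (T s).1 y = 0 := by
  set r : A := s - ∑ n ∈ K, q n with hr
  have hsum : ∀ (f : ℕ → A) (x : X), (∑ n ∈ K, f n : A).1 x = ∑ n ∈ K, (f n).1 x := fun f x => by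
    simp
  have hsum' : ∀ (f : ℕ → B) (x : Y), (∑ n ∈ K, f n : B).1 x = ∑ n ∈ K, (f n).1 x := fun f x => by
    simp
  have hTr : (T r).1 y = (T s).1 y := by
    have : (T r).1 y = (T s).1 y - (∑ n ∈ K, T (q n) : B).1 y := by rw [hr, map_sub, map_sum]; rfl
    rw [this, hsum', Finset.sum_eq_zero fun n _ => hy n, sub_zero]
  have hrx : ∀ x, r.1 x = s.1 x - ∑ n ∈ K, (q n).1 x := fun x => by
    rw [← hsum]; rfl
  rw [← hTr]
  by_contra hne
  obtain ⟨b, hb, -, hb1, hb0⟩ := hB.bump y _ hK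
  obtain ⟨m, hm⟩ := hB.exists_smul hb (T r)
  have hmy : m.1 y ≠ 0 := by
    rw [hm, hb1.self_of_nhds]; simpa using hne
  obtain ⟨m', rfl⟩ := T.surjective m
  have hrn : ∀ n ∈ K, DisjCoz r.1 (q n).1 := by
    intro n hn x
    by_cases hx : (q n).1 x = 0
    · exact Or.inr hx
    · left
      rw [hrx, h.eq hx, Finset.sum_eq_single_of_mem n hn, sub_self]
      intro k _ hk
      by_contra hkx
      exact hk (h.disj k n x hkx hx)
  have hmn : ∀ n, DisjCoz m'.1 (q n).1 := by
    intro n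
    rw [hT]
    intro z
    by_cases hn : n ∈ K
    · rcases (hT _ _).1 (hrn n hn) z with h0 | h0
      · left; rw [hm, h0, smul_zero]
      · exact Or.inr h0
    · by_cases hz : (T (q n)).1 z = 0
      · exact Or.inr hz
      · left
        rw [hm, hb0 z fun hz' => hz (hz' n hn)]; simp
  refine hne (hT.eq_zero (f := m') (fun x hx => ?_) hmy)
  have h0 : ∀ n, (q n).1 x = 0 := fun n => (hmn n x).resolve_left hx
  rw [hrx, h.sum_eq]
  simp [h0]

/-- Where `T (q n)` is nonzero, `T g = n • T s`. If `T s y ≠ 0`, local boundedness of `T g` bounds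
the indices `n` active near `y`. -/
theorem IsDisjSum.apply_eq_zero_of_weights {T : A ≃ₗ[𝕜] B} (hT : PresDisj T)
    (hB : Admissible S' B) {q : ℕ → A} {s g : A} (h : IsDisjSum q s)
    (hg : ∀ n x, (q n).1 x ≠ 0 → g.1 x = (n : 𝕜) • (q n).1 x) {y : Y}
    (hy : ∀ n, (T (q n)).1 y = 0) : (T s).1 y = 0 := by
  by_contra hne
  have hδ : 0 < ‖(T s).1 y‖ / 2 := half_pos (norm_pos_iff.2 hne)
  set δ := ‖(T s).1 y‖ / 2
  set M := ‖(T g).1 y‖ + 1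
  have h1 : ∀ᶠ z in 𝓝 y, ‖(T g).1 z‖ < M :=
    (T g).1.continuous.norm.continuousAt.eventually_lt continuousAt_const (lt_add_one _)
  have h2 : ∀ᶠ z in 𝓝 y, δ < ‖(T s).1 z‖ :=
    continuousAt_const.eventually_lt (T s).1.continuous.norm.continuousAt
      (half_lt_self (norm_pos_iff.2 hne))
  refine hne (h.apply_eq_zero hT hB (Finset.range (⌈M / δ⌉₊ + 1)) ?_ hy)
  filter_upwards [h1, h2] with z hz1 hz2 n hn
  by_contra hz
  have e1 : (T s).1 z = (T (q n)).1 z := hT.eq_of_eq (fun x hx => h.eq hx) hz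
  have e2 : (T g).1 z = (T ((n : 𝕜) • q n)).1 z := hT.eq_of_eq (fun x hx => hg n x hx) hz
  have e3 : ‖(T g).1 z‖ = n * ‖(T s).1 z‖ := by
    rw [e2, e1, map_smul]
    change ‖(n : 𝕜) • (T (q n)).1 z‖ = _
    rw [norm_smul, RCLike.norm_natCast]
  have hn' : M / δ < n := by
    have : ⌈M / δ⌉₊ + 1 ≤ n := by simpa using hn
    have h3 := Nat.le_ceil (M / δ)
    have : ((⌈M / δ⌉₊ : ℝ)) + 1 ≤ n := by exact_mod_cast this
    linarith
  rw [div_lt_iff₀ hδ] at hn'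
  have : (n : ℝ) * δ ≤ n * ‖(T s).1 z‖ := by gcongr
  linarith

/-- Where `T (q n)` is nonzero, `T b` takes the value `d n`. Near `y` the values of `T b` lie in a
ball of radius `1 / 2`, which contains at most one `d n`. -/
theorem IsDisjSum.apply_eq_zero_of_separated {T : A ≃ₗ[𝕜] B} (hT : PresDisj T)
    (hB : Admissible S' B) {q : ℕ → A} {s b : A} (h : IsDisjSum q s) {d : ℕ → F}
    (hd : ∀ n m, n ≠ m → 1 ≤ ‖d n - d m‖) {a : ℕ → A} (ha : ∀ n z, (T (a n)).1 z = d n)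
    (hb : ∀ n x, (q n).1 x ≠ 0 → b.1 x = (a n).1 x) {y : Y}
    (hy : ∀ n, (T (q n)).1 y = 0) : (T s).1 y = 0 := by
  have h1 : ∀ᶠ z in 𝓝 y, ‖(T b).1 z - (T b).1 y‖ < 1 / 2 := by
    have : ContinuousAt (fun z => ‖(T b).1 z - (T b).1 y‖) y := by fun_prop
    exact this.eventually_lt continuousAt_const (by simp)
  have e : ∀ n z, (T (q n)).1 z ≠ 0 → (T b).1 z = d n := fun n z hz => by
    rw [hT.eq_of_eq (fun x hx => hb n x hx) hz, ha]
  by_cases hex : ∃ n z, ‖(T b).1 z - (T b).1 y‖ < 1 / 2 ∧ (T (q n)).1 z ≠ 0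
  · obtain ⟨n, z, hz, hqz⟩ := hex
    refine h.apply_eq_zero hT hB {n} ?_ hy
    filter_upwards [h1] with w hw m hm
    by_contra hqw
    have h2 := hd n m (by simpa [eq_comm] using hm)
    rw [← e n z hqz, ← e m w hqw] at h2
    have h3 : (T b).1 z - (T b).1 w
      = ((T b).1 z - (T b).1 y) - ((T b).1 w - (T b).1 y) := by abel
    have := norm_sub_le ((T b).1 z - (T b).1 y) ((T b).1 w - (T b).1 y)
    rw [← h3] at this
    linarith
  · push Not at hex
    refine h.apply_eq_zero hT hB ∅ ?_ hy
    filter_upwards [h1] with w hw m _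
    exact hex m w hw

/-- At each point at most one term survives, so the tail after `N` terms is bounded by the supremum
of the later `δ n`, and partial sums converge uniformly. -/
theorem Admissible.exists_disjSum (hA : Admissible S A) {q : ℕ → A}
    (hq : ∀ n m x, (q n).1 x ≠ 0 → (q m).1 x ≠ 0 → n = m) {δ : ℕ → ℝ}
    (hδ : Tendsto δ atTop (𝓝 0)) (hqδ : ∀ n x, ‖(q n).1 x‖ ≤ δ n) :
    ∃ s : A, IsDisjSum q s := by
  have hsum : ∀ (N : ℕ) (x : X), (∑ n ∈ Finset.range N, q n : A).1 x
      = ∑ n ∈ Finset.range N, (q n).1 x := fun f x => by simp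
  obtain ⟨g, hg, hgx⟩ := hA.lim_mem (fun N => (∑ n ∈ Finset.range N, q n : A).1)
    (fun N => (∑ n ∈ Finset.range N, q n : A).2) (fun x => ∑ᶠ n, (q n).1 x) (by
      rw [Metric.tendstoUniformly_iff]
      intro ε hε
      obtain ⟨N₀, hN₀⟩ := eventually_atTop.1 (hδ.eventually_lt_const hε)
      filter_upwards [eventually_ge_atTop N₀] with N hN x
      rw [hsum, dist_eq_norm]
      by_cases hx : ∃ n, (q n).1 x ≠ 0
      · obtain ⟨n, hn⟩ := hx
        have h0 : ∀ m, m ≠ n → (q m).1 x = 0 := fun m hm => by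
          by_contra hmx; exact hm (hq m n x hmx hn)
        rw [finsum_eq_single _ n h0]
        by_cases hnN : n < N
        · rw [Finset.sum_eq_single_of_mem n (by simpa using hnN) fun m _ hm => h0 m hm]
          simpa using hε
        · rw [Finset.sum_eq_zero fun m hm => h0 m ?_, sub_zero]
          · exact (hqδ n x).trans_lt (hN₀ n (by omega))
          · have := Finset.mem_range.1 hm
            omega
      · push Not at hx
        simpa [hx] using hε)
  exact ⟨⟨g, hg⟩, hq, hgx⟩

end Abstract

/-! ### Dyadic partition of unity on the half-line -/

section Shells

/-- The ramp from `0` at `1 / 2` to `1` at `1`. -/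
noncomputable def ramp (s : ℝ) : ℝ := max 0 (min 1 (2 * s - 1))

theorem uniformContinuous_ramp : UniformContinuous ramp := by
  refine LipschitzWith.uniformContinuous (K := 2) ((LipschitzWith.of_dist_le_mul ?_).const_min 1 |>.const_max 0)
  intro x y
  rw [Real.dist_eq, Real.dist_eq, show 2 * x - 1 - (2 * y - 1) = 2 * (x - y) by ring, abs_mul]
  simp

theorem ramp_nonneg (s : ℝ) : 0 ≤ ramp s := le_max_left _ _

theorem ramp_le_one (s : ℝ) : ramp s ≤ 1 := max_le zero_le_one (min_le_left _ _)

theorem ramp_eq_zero {s : ℝ} (h : s ≤ 1 / 2) : ramp s = 0 :=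
  max_eq_left ((min_le_right _ _).trans (by linarith))

theorem ramp_eq_one {s : ℝ} (h : 1 ≤ s) : ramp s = 1 := by
  rw [ramp, min_eq_left (by linarith), max_eq_right zero_le_one]

/-- A tent function on the dyadic shell `2⁻ⁿ⁻¹ < t < 2⁻ⁿ⁺¹`. -/
noncomputable def shell (n : ℕ) (t : ℝ) : ℝ := ramp (2 ^ n * t) - ramp (2 ^ n * t / 2)

/-- A function on `2⁻ⁿ⁻² < t < 2⁻ⁿ⁺²` which is `1` on the dyadic shell `2⁻ⁿ⁻¹ < t < 2⁻ⁿ⁺¹`. -/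
noncomputable def plateau (n : ℕ) (t : ℝ) : ℝ := ramp (2 * (2 ^ n * t)) - ramp (2 ^ n * t / 4)

theorem uniformContinuous_shell (n : ℕ) : UniformContinuous (shell n) := by
  have h1 : UniformContinuous fun t : ℝ => ramp (2 ^ n * t) :=
    uniformContinuous_ramp.comp (Real.uniformContinuous_const_mul)
  have h2 : UniformContinuous fun t : ℝ => ramp (2 ^ n * t / 2) := by
    have e : (fun t : ℝ => ramp (2 ^ n * t / 2)) = fun t => ramp (2 ^ n / 2 * t) := by
      ext t; congr 1; ring
    rw [e]
    exact uniformContinuous_ramp.comp Real.uniformContinuous_const_mul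
  exact h1.sub h2

theorem continuous_plateau (n : ℕ) : Continuous (plateau n) := by
  have := uniformContinuous_ramp.continuous
  unfold plateau
  fun_prop

theorem abs_ramp_sub_ramp_le (s t : ℝ) : |ramp s - ramp t| ≤ 1 :=
  abs_le.2 ⟨by linarith [ramp_nonneg s, ramp_le_one t], by linarith [ramp_nonneg t, ramp_le_one s]⟩

theorem abs_shell_le (n : ℕ) (t : ℝ) : |shell n t| ≤ 1 := abs_ramp_sub_ramp_le _ _

theorem abs_plateau_le (n : ℕ) (t : ℝ) : |plateau n t| ≤ 1 := abs_ramp_sub_ramp_le _ _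

theorem shell_ne_zero {n : ℕ} {t : ℝ} (h : shell n t ≠ 0) : 1 / 2 < 2 ^ n * t ∧ 2 ^ n * t < 2 := by
  unfold shell at h
  refine ⟨?_, ?_⟩ <;> by_contra! hc <;> apply h
  · rw [ramp_eq_zero hc, ramp_eq_zero (by linarith), sub_self]
  · rw [ramp_eq_one (by linarith), ramp_eq_one (by linarith), sub_self]

theorem plateau_ne_zero {n : ℕ} {t : ℝ} (h : plateau n t ≠ 0) :
    1 / 4 < 2 ^ n * t ∧ 2 ^ n * t < 4 := by
  unfold plateau at h
  refine ⟨?_, ?_⟩ <;> by_contra! hc <;> apply h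
  · rw [ramp_eq_zero (by linarith), ramp_eq_zero (by linarith), sub_self]
  · rw [ramp_eq_one (by linarith), ramp_eq_one (by linarith), sub_self]

theorem plateau_eq_one {n : ℕ} {t : ℝ} (h : shell n t ≠ 0) : plateau n t = 1 := by
  obtain ⟨h1, h2⟩ := shell_ne_zero h
  rw [plateau, ramp_eq_one (by linarith), ramp_eq_zero (by linarith), sub_zero]

/-- Each plateau spans a ratio of `16 = 2 ^ 4`, so plateaus whose indices differ by at least 4 are
disjoint. -/
theorem eq_of_plateau_ne_zero {n m : ℕ} {t : ℝ} (hnm : n % 4 = m % 4) (hn : plateau n t ≠ 0)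
    (hm : plateau m t ≠ 0) : n = m := by
  wlog h : n ≤ m generalizing n m
  · exact (this hnm.symm hm hn (by omega)).symm
  by_contra hne
  obtain ⟨k, rfl⟩ : ∃ k, m = n + 4 + k := ⟨m - (n + 4), by omega⟩
  have h1 := (plateau_ne_zero hn).1
  have h2 := (plateau_ne_zero hm).2
  have h3 : (1 : ℝ) ≤ 2 ^ k := one_le_pow₀ one_le_two
  rw [pow_add, pow_add] at h2
  nlinarith

theorem exists_two_pow_mul_ge {t : ℝ} (ht : 0 < t) (c : ℝ) : ∃ N : ℕ, ∀ n ≥ N, c ≤ 2 ^ n * t := by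
  obtain ⟨N, hN⟩ := pow_unbounded_of_one_lt (c / t) one_lt_two
  refine ⟨N, fun n hn => ?_⟩
  have : (2 : ℝ) ^ N ≤ 2 ^ n := pow_le_pow_right₀ one_le_two hn
  rw [div_lt_iff₀ ht] at hN
  nlinarith

theorem exists_sum_shell {t : ℝ} (h0 : 0 < t) (h1 : t ≤ 1) :
    ∃ N : ℕ, (∀ n ≥ N, shell n t = 0) ∧ ∑ n ∈ Finset.range N, shell n t = 1 := by
  obtain ⟨N, hN⟩ := exists_two_pow_mul_ge h0 2
  refine ⟨N, fun n hn => ?_, ?_⟩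
  · by_contra h
    exact absurd (hN n hn) (not_le.2 (shell_ne_zero h).2)
  · have : ∀ n, shell n t = ramp (2 ^ (n + 1) * t / 2) - ramp (2 ^ n * t / 2) := fun n => by
      rw [shell]; congr 2; ring
    simp only [this]
    rw [Finset.sum_range_sub (fun n => ramp (2 ^ n * t / 2)), ramp_eq_one (by linarith [hN N le_rfl]),
      ramp_eq_zero (by simpa using by linarith), sub_zero]

end Shells

/-! ### Vanishing at a support point, and the weighted composition form -/

section Pieces

variable {𝕜 : Type*} [RCLike 𝕜] {X Y E F : Type*} [TopologicalSpace X] [TopologicalSpace Y]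
  [NormedAddCommGroup E] [NormedSpace 𝕜 E] [NormedAddCommGroup F] [NormedSpace 𝕜 F]
  {S : Set (X → ℝ)} {S' : Set (Y → ℝ)}
  {A : Submodule 𝕜 C(X, E)} {B : Submodule 𝕜 C(Y, F)}

theorem ite_apply_zero (i n : ℕ) (k : ℕ → A) (x : X) :
    (if n % 4 = i then k n else 0 : A).1 x = if n % 4 = i then (k n).1 x else 0 := by
  split_ifs <;> rfl

theorem shell_pieces_disjoint {v : X → ℝ} {f : A} {k : ℕ → A}
    (hk : ∀ n x, (k n).1 x = (shell n (v x) : 𝕜) • f.1 x) (i n m : ℕ) (x : X)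
    (hn : (if n % 4 = i then k n else 0 : A).1 x ≠ 0)
    (hm : (if m % 4 = i then k m else 0 : A).1 x ≠ 0) : n = m := by
  rw [ite_apply_zero] at hn hm
  have hn' := ite_ne_right_iff.1 hn
  have hm' := ite_ne_right_iff.1 hm
  have aux : ∀ n, (k n).1 x ≠ 0 → plateau n (v x) ≠ 0 := fun n h => by
    have : shell n (v x) ≠ 0 := fun h0 => h (by rw [hk, h0]; simp)
    rw [plateau_eq_one this]; exact one_ne_zero
  exact eq_of_plateau_ne_zero (hn'.1.trans hm'.1.symm) (aux n hn'.2) (aux m hm'.2)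

theorem eq_sum_shell_pieces {v : X → ℝ} {f : A} (hv : ∀ x, f.1 x ≠ 0 → 0 < v x ∧ v x ≤ 1)
    {k : ℕ → A} (hk : ∀ n x, (k n).1 x = (shell n (v x) : 𝕜) • f.1 x) {s : ℕ → A}
    (hs : ∀ i, IsDisjSum (fun n => if n % 4 = i then k n else 0 : ℕ → A) (s i)) :
    f = ∑ i ∈ Finset.range 4, s i := by
  ext x
  have hsum : (∑ i ∈ Finset.range 4, s i : A).1 x = ∑ i ∈ Finset.range 4, (s i).1 x := by simp
  rw [hsum]
  simp only [fun i => (hs i).sum_eq x, ite_apply_zero]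
  by_cases hx : f.1 x = 0
  · simp [hk, hx]
  obtain ⟨N, hN, hN1⟩ := exists_sum_shell (hv x hx).1 (hv x hx).2
  have h1 : ∀ i, ∑ᶠ n, (if n % 4 = i then (k n).1 x else 0)
      = ∑ n ∈ Finset.range N, (if n % 4 = i then (k n).1 x else 0) := fun i => by
    refine finsum_eq_sum_of_support_subset _ fun n hn => ?_
    have hn' := (ite_ne_right_iff.1 (Function.mem_support.1 hn)).2
    by_contra h
    exact hn' (by rw [hk, hN n (by simpa using h)]; simp)
  simp only [h1]
  rw [Finset.sum_comm]
  have h2 : ∀ n, ∑ i ∈ Finset.range 4, (if n % 4 = i then (k n).1 x else 0) = (k n).1 x :=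
    fun n => by
      rw [Finset.sum_ite_eq, if_pos]
      exact Finset.mem_range.2 (Nat.mod_lt _ (by norm_num))
  rw [Finset.sum_congr rfl fun n _ => h2 n]
  simp only [hk]
  rw [← Finset.sum_smul, ← RCLike.ofReal_sum, hN1]
  simp

theorem apply_eq_zero_of_shell_pieces (T : A ≃ₗ[𝕜] B) {v : X → ℝ} {f : A}
    (hv : ∀ x, f.1 x ≠ 0 → 0 < v x ∧ v x ≤ 1)
    {k : ℕ → A} (hk : ∀ n x, (k n).1 x = (shell n (v x) : 𝕜) • f.1 x) {y : Y}
    (hs : ∀ i, ∃ s : A, IsDisjSum (fun n => if n % 4 = i then k n else 0 : ℕ → A) s ∧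
      (T s).1 y = 0) : (T f).1 y = 0 := by
  choose s hs hs0 using hs
  rw [eq_sum_shell_pieces hv hk hs, map_sum]
  have hsum : (∑ i ∈ Finset.range 4, T (s i) : B).1 y
    = ∑ i ∈ Finset.range 4, (T (s i)).1 y := by simp
  rw [hsum, Finset.sum_eq_zero fun i _ => hs0 i]

theorem IsSupp.apply_eq_zero {T : A ≃ₗ[𝕜] B} (hT : PresDisj T) (hA : Admissible S A)
    (hB : Admissible S' B) {y : Y} {x : X} (hx : IsSupp T y x) {f : A} (hf : f.1 x = 0) :
    (T f).1 y = 0 := by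
  -- The shells sum to `1` only on `(0, 1]`; multiplying by a bump at `x` changes `f` only away from
  -- `x`, which the functional does not see.
  wlog hf1 : ∀ p, ‖f.1 p‖ ≤ 1 generalizing f
  · have hU : ∀ᶠ p in 𝓝 x, ‖f.1 p‖ < 1 :=
      f.1.continuous.norm.continuousAt.eventually_lt continuousAt_const (by simp [hf])
    obtain ⟨b, hb, hb01, hb1, hb0⟩ := hA.bump x _ hU
    obtain ⟨g, hg⟩ := hA.exists_smul hb f
    have h1 : (T g).1 y = 0 := by
      refine this (by rw [hg, hf, smul_zero]) fun p => ?_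
      by_cases hp : ‖f.1 p‖ < 1
      · rw [hg, norm_smul, RCLike.norm_ofReal, abs_of_nonneg (hb01 p).1]
        exact mul_le_one₀ (hb01 p).2 (norm_nonneg _) hp.le
      · rw [hg, hb0 p hp]; simp
    have h2 : (T (f - g)).1 y = 0 := by
      refine hx.eq_zero hT ?_
      filter_upwards [hb1] with p hp
      change f.1 p - g.1 p = 0
      rw [hg, hp]; simp
    rw [map_sub] at h2
    have h3 : (T f).1 y - (T g).1 y = 0 := h2
    rwa [h1, sub_zero] at h3
  have hk : ∀ n, ∃ k : A, ∀ x, k.1 x = (shell n ‖f.1 x‖ : 𝕜) • f.1 x := fun n =>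
    hA.exists_smul (hA.comp_norm_mem f.1 f.2 _ (uniformContinuous_shell n)
      ⟨1, fun t _ => abs_shell_le n t⟩) f
  choose k hk using hk
  have hk0 : ∀ n, (T (k n)).1 y = 0 := fun n => by
    refine hx.eq_zero hT ?_
    have : ∀ᶠ p in 𝓝 x, 2 ^ n * ‖f.1 p‖ < 1 / 2 := by
      have : ContinuousAt (fun p => 2 ^ n * ‖f.1 p‖) x := by fun_prop
      exact this.eventually_lt continuousAt_const (by simp [hf])
    filter_upwards [this] with p hp
    by_contra h
    rw [hk] at h
    have h' : shell n ‖f.1 p‖ ≠ 0 := fun h0 => h (by rw [h0]; simp)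
    exact absurd (shell_ne_zero h').1 (not_lt.2 hp.le)
  have hkn : ∀ n p, ‖(k n).1 p‖ ≤ 2 * (1 / 2) ^ n := fun n p => by
    rw [hk, norm_smul, RCLike.norm_ofReal]
    by_cases h : shell n ‖f.1 p‖ = 0
    · rw [h]; simp
    · have h1 := (shell_ne_zero h).2
      have h2 := abs_shell_le n ‖f.1 p‖
      have h3 : ‖f.1 p‖ ≤ 2 * (1 / 2) ^ n := by
        rw [one_div, inv_pow, ← div_eq_mul_inv, le_div_iff₀ (by positivity)]
        linarith
      calc _ ≤ 1 * ‖f.1 p‖ := by gcongr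
        _ ≤ _ := by linarith
  have hlim1 : Tendsto (fun n : ℕ => 2 * (1 / 2 : ℝ) ^ n) atTop (𝓝 0) := by
    simpa using (tendsto_pow_atTop_nhds_zero_of_lt_one (r := (1 / 2 : ℝ))
      (by norm_num) (by norm_num)).const_mul 2
  have hlim2 : Tendsto (fun n : ℕ => n * (2 * (1 / 2 : ℝ) ^ n)) atTop (𝓝 0) := by
    have := (tendsto_self_mul_const_pow_of_lt_one (r := (1 / 2 : ℝ))
      (by norm_num) (by norm_num)).const_mul 2
    rw [mul_zero] at this
    exact this.congr fun n => by ring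
  refine apply_eq_zero_of_shell_pieces T (v := fun x => ‖f.1 x‖)
    (fun p hp => ⟨norm_pos_iff.2 hp, hf1 p⟩) hk fun i => ?_
  have hd := shell_pieces_disjoint (v := fun x => ‖f.1 x‖) hk i
  have hqn : ∀ n p, ‖(if n % 4 = i then k n else 0 : A).1 p‖ ≤ 2 * (1 / 2) ^ n := fun n p => by
    rw [ite_apply_zero]
    split_ifs
    · exact hkn n p
    · simp
  obtain ⟨s, hs⟩ := hA.exists_disjSum hd hlim1 hqn
  obtain ⟨g, hg⟩ := hA.exists_disjSum
    (q := fun n => (n : 𝕜) • (if n % 4 = i then k n else 0 : A))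
    (fun n m x hn hm => hd n m x (right_ne_zero_of_smul hn) (right_ne_zero_of_smul hm))
    hlim2 (fun n p => by
      change ‖(n : 𝕜) • (if n % 4 = i then k n else 0 : A).1 p‖ ≤ _
      rw [norm_smul, RCLike.norm_natCast]
      exact mul_le_mul_of_nonneg_left (hqn n p) (Nat.cast_nonneg n))
  refine ⟨s, hs, hs.apply_eq_zero_of_weights hT hB (g := g) (fun n p hp => ?_) fun n => ?_⟩
  · by_cases hn : n = 0
    · subst hn
      by_contra hne
      obtain ⟨m, hm⟩ := hg.exists_ne (x := p) (by simpa using hne)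
      have := hd m 0 p (right_ne_zero_of_smul hm) hp
      subst this
      exact hm (by simp)
    · have hnp : ((n : 𝕜) • (if n % 4 = i then k n else 0 : A)).1 p ≠ 0 :=
        smul_ne_zero (Nat.cast_ne_zero.2 hn) hp
      exact hg.eq hnp
  · split_ifs
    · exact hk0 n
    · simp

/-- If all support points exist in both directions then `T` is a weighted composition map. -/
theorem exists_homeomorph [T2Space X] [T2Space Y] [Nontrivial E] [Nontrivial F]
    {T : A ≃ₗ[𝕜] B} (hT : PresDisj T) (hA : Admissible S A)
    (hB : Admissible S' B) (hX : ∀ y, ∃ x, IsSupp T y x) (hY : ∀ x, ∃ y, IsSupp T.symm x y) :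
    ∃ (h : Y ≃ₜ X) (J : Y → (E ≃ₗ[𝕜] F)), ∀ (f : A) (y : Y), (T f).1 y = J y (f.1 (h y)) := by
  choose h hh using hX
  choose k hk using hY
  have hT0 : ∀ (f : A) y, f.1 (h y) = 0 → (T f).1 y = 0 := fun f y hf =>
    (hh y).apply_eq_zero hT hA hB hf
  have hS0 : ∀ (g : B) x, g.1 (k x) = 0 → (T.symm g).1 x = 0 := fun g x hg =>
    (hk x).apply_eq_zero hT.symm hB hA hg
  have hT1 : ∀ (f g : A) y, f.1 (h y) = g.1 (h y) → (T f).1 y = (T g).1 y := fun f g y hfg => by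
    have := hT0 (f - g) y (sub_eq_zero.2 hfg)
    rw [map_sub] at this
    exact sub_eq_zero.1 this
  have hS1 : ∀ (f g : B) x, f.1 (k x) = g.1 (k x) → (T.symm f).1 x = (T.symm g).1 x :=
    fun f g y hfg => by
      have := hS0 (f - g) y (sub_eq_zero.2 hfg)
      rw [map_sub] at this
      exact sub_eq_zero.1 this
  have hkh : ∀ y, k (h y) = y := fun y => by
    by_contra hne
    obtain ⟨s, hs, -, hs1, hs0⟩ := hB.bump y {k (h y)}ᶜ
      (isOpen_compl_singleton.mem_nhds fun e => hne e.symm)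
    obtain ⟨w, hw⟩ := exists_ne (0 : F)
    obtain ⟨c, hc⟩ := hB.exists_const w
    obtain ⟨g, hg⟩ := hB.exists_smul hs c
    have h1 := hT0 (T.symm g) y (hS0 g _ (by rw [hg, hs0 _ (by simp)]; simp))
    rw [T.apply_symm_apply, hg, hs1.self_of_nhds, hc] at h1
    exact hw (by simpa using h1)
  have hhk : ∀ x, h (k x) = x := fun x => by
    by_contra hne
    obtain ⟨s, hs, -, hs1, hs0⟩ := hA.bump x {h (k x)}ᶜ
      (isOpen_compl_singleton.mem_nhds fun e => hne e.symm)
    obtain ⟨w, hw⟩ := exists_ne (0 : E)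
    obtain ⟨c, hc⟩ := hA.exists_const w
    obtain ⟨g, hg⟩ := hA.exists_smul hs c
    have h1 := hS0 (T g) x (hT0 g _ (by rw [hg, hs0 _ (by simp)]; simp))
    rw [T.symm_apply_apply, hg, hs1.self_of_nhds, hc] at h1
    exact hw (by simpa using h1)
  -- If `f` lives in `U` and `T f y ≠ 0`, then `T f ≠ 0` near `y`, which forces `h z ∈ U` for `z`
  -- near `y`.
  have hcont : Continuous h := continuous_iff_continuousAt.2 fun y => tendsto_def.2 fun U hU => by
    obtain ⟨f, hfy, hf⟩ := hh y U hU
    have : ∀ᶠ z in 𝓝 y, (T f).1 z ≠ 0 := (T f).1.continuous.continuousAt.eventually_ne hfy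
    filter_upwards [this] with z hz using by_contra fun hzU => hz (hT0 f z (hf _ hzU))
  have kcont : Continuous k := continuous_iff_continuousAt.2 fun x => tendsto_def.2 fun U hU => by
    obtain ⟨f, hfy, hf⟩ := hk x U hU
    have : ∀ᶠ z in 𝓝 x, (T.symm f).1 z ≠ 0 :=
      (T.symm f).1.continuous.continuousAt.eventually_ne hfy
    filter_upwards [this] with z hz using by_contra fun hzU => hz (hS0 f z (hf _ hzU))
  let cX : E → A := fun e => ⟨_, hA.const_mem e⟩
  let cY : F → B := fun e => ⟨_, hB.const_mem e⟩
  let J : Y → (E ≃ₗ[𝕜] F) := fun y =>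
    { toFun := fun e => (T (cX e)).1 y
      map_add' := fun e e' => by
        rw [show cX (e + e') = cX e + cX e' from rfl, map_add]; rfl
      map_smul' := fun c e => by
        rw [show cX (c • e) = c • cX e from rfl, map_smul]; rfl
      invFun := fun w => (T.symm (cY w)).1 (h y)
      left_inv := fun e => by
        have := hS1 (cY ((T (cX e)).1 y)) (T (cX e)) (h y) (by rw [hkh]; rfl)
        rw [T.symm_apply_apply] at this
        exact this
      right_inv := fun w => by
        have := hT1 (cX ((T.symm (cY w)).1 (h y))) (T.symm (cY w)) y rfl
        rw [T.apply_symm_apply] at this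
        exact this }
  exact ⟨⟨⟨h, k, hkh, hhk⟩, hcont, kcont⟩, J, fun f y => hT1 f (cX (f.1 (h y))) y rfl⟩

end Pieces

/-! ### Support points over realcompact spaces -/

section Realcompact

variable {𝕜 : Type*} [RCLike 𝕜] {X Y E F : Type*} [TopologicalSpace X] [TopologicalSpace Y]
  [NormedAddCommGroup E] [NormedSpace 𝕜 E] [NormedAddCommGroup F] [NormedSpace 𝕜 F]

/-- The bounded continuous real functions. -/
def bddCont (X : Type*) [TopologicalSpace X] : Set (X → ℝ) :=
  {s | Continuous s ∧ ∃ C, ∀ x, |s x| ≤ C}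

theorem exists_bump [CompletelyRegularSpace X] (x : X) {U : Set X} (hU : U ∈ 𝓝 x) :
    ∃ s ∈ bddCont X, (∀ p, 0 ≤ s p ∧ s p ≤ 1) ∧ (∀ᶠ p in 𝓝 x, s p = 1) ∧ ∀ p ∉ U, s p = 0 := by
  obtain ⟨g, hg, hgx, hgU⟩ := CompletelyRegularSpace.completely_regular_isOpen x (interior U)
    isOpen_interior (mem_interior_iff_mem_nhds.2 hU)
  have hc : Continuous fun p => (g p : ℝ) := continuous_subtype_val.comp hg
  refine ⟨fun p => ramp (2 * (1 - g p)), ⟨?_, 1, fun p => ?_⟩, fun p => ⟨ramp_nonneg _, ramp_le_one _⟩,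
    ?_, fun p hp => ?_⟩
  · have := uniformContinuous_ramp.continuous
    fun_prop
  · rw [abs_of_nonneg (ramp_nonneg _)]; exact ramp_le_one _
  · have : ∀ᶠ p in 𝓝 x, (g p : ℝ) < 1 / 2 :=
      hc.continuousAt.eventually_lt continuousAt_const (by simp [hgx])
    filter_upwards [this] with p hp using ramp_eq_one (by linarith)
  · have : g p = 1 := hgU fun h => hp (interior_subset h)
    simp only [this]
    exact ramp_eq_zero (by norm_num)

theorem admissible_contFun [CompletelyRegularSpace X] :
    Admissible (bddCont X) (contFun 𝕜 X E) where
  const_mem _ := Submodule.mem_top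
  smul_mem s hs f _ := ⟨⟨fun x => (s x : 𝕜) • f x,
    (RCLike.continuous_ofReal.comp hs.1).smul f.continuous⟩, Submodule.mem_top, fun _ => rfl⟩
  comp_norm_mem f _ θ hθ hb := ⟨hθ.continuous.comp f.continuous.norm, by
    obtain ⟨C, hC⟩ := hb
    exact ⟨C, fun x => hC _ (norm_nonneg _)⟩⟩
  lim_mem f _ g hg := ⟨⟨g, hg.continuous (Frequently.of_forall fun n => (f n).continuous)⟩,
    Submodule.mem_top, fun _ => rfl⟩
  bump x _ hU := exists_bump x hU

theorem exists_bound_of_tendstoUniformly {X E : Type*} [NormedAddCommGroup E] {f : ℕ → X → E} {g : X → E}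
    (hf : ∀ n, ∃ C : ℝ, ∀ x, ‖f n x‖ ≤ C) (hg : TendstoUniformly f g atTop) :
    ∃ C : ℝ, ∀ x, ‖g x‖ ≤ C := by
  obtain ⟨n, hn⟩ := (Metric.tendstoUniformly_iff.1 hg 1 one_pos).exists
  obtain ⟨C, hC⟩ := hf n
  refine ⟨1 + C, fun x => ?_⟩
  have h1 := (hn x).le
  rw [dist_eq_norm] at h1
  calc ‖g x‖ = ‖(g x - f n x) + f n x‖ := by rw [sub_add_cancel]
    _ ≤ _ := (norm_add_le _ _).trans (add_le_add h1 (hC x))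

theorem exists_bound_smul {X E : Type*} [NormedAddCommGroup E] [NormedSpace 𝕜 E] {s : X → ℝ} {f : X → E} (hs : ∃ C, ∀ x, |s x| ≤ C)
    (hf : ∃ C : ℝ, ∀ x, ‖f x‖ ≤ C) : ∃ C : ℝ, ∀ x, ‖(s x : 𝕜) • f x‖ ≤ C := by
  obtain ⟨C, hC⟩ := hs
  obtain ⟨D, hD⟩ := hf
  refine ⟨C * D, fun x => ?_⟩
  rw [norm_smul, RCLike.norm_ofReal]
  exact mul_le_mul (hC x) (hD x) (norm_nonneg _) ((abs_nonneg _).trans (hC x))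

theorem admissible_boundedContFun [CompletelyRegularSpace X] :
    Admissible (bddCont X) (boundedContFun 𝕜 X E) where
  const_mem e := ⟨‖e‖, fun _ => le_rfl⟩
  smul_mem s hs f hf := ⟨⟨fun x => (s x : 𝕜) • f x,
    (RCLike.continuous_ofReal.comp hs.1).smul f.continuous⟩, exists_bound_smul hs.2 hf,
      fun _ => rfl⟩
  comp_norm_mem f _ θ hθ hb := ⟨hθ.continuous.comp f.continuous.norm, by
    obtain ⟨C, hC⟩ := hb
    exact ⟨C, fun x => hC _ (norm_nonneg _)⟩⟩
  lim_mem f hf g hg := ⟨⟨g, hg.continuous (Frequently.of_forall fun n => (f n).continuous)⟩,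
    exists_bound_of_tendstoUniformly hf hg, fun _ => rfl⟩
  bump x _ hU := exists_bump x hU

variable {A : Submodule 𝕜 C(X, E)} {B : Submodule 𝕜 C(Y, F)}

/-- The functional `f ↦ T f y` is carried by finitely many dyadic shells of every positive
continuous function. -/
def ShellBounded (T : A ≃ₗ[𝕜] B) (y : Y) : Prop :=
  ∀ v : X → ℝ, Continuous v → (∀ x, 0 < v x ∧ v x ≤ 1) → ∀ f : A, (T f).1 y ≠ 0 →
    ∃ (n : ℕ) (k : A), (∀ x, k.1 x = (shell n (v x) : 𝕜) • f.1 x) ∧ (T k).1 y ≠ 0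

/-- The functions whose restriction to the carrier of `f ↦ T f y` vanishes. -/
def CarrierZero (T : A ≃ₗ[𝕜] B) (y : Y) (u : C(X, ℝ)) : Prop :=
  ∀ ε > 0, ∃ f : A, (T f).1 y ≠ 0 ∧ ∀ p, f.1 p ≠ 0 → |u p| < ε

/-- This is the filter property of carriers: a cutoff of `f` that is `1` where `|u| < ε / 2` has the
same image at `y`, by locality. It makes the ideal below closed under sums and products. -/
theorem CarrierZero.inter {T : A ≃ₗ[𝕜] B} (hT : PresDisj T) (hA : Admissible (bddCont X) A)
    {y : Y} {u : C(X, ℝ)} (hu : CarrierZero T y u) {f : A} (hf : (T f).1 y ≠ 0) {ε : ℝ}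
    (hε : 0 < ε) : ∃ g : A, (T g).1 y ≠ 0 ∧ ∀ p, g.1 p ≠ 0 → f.1 p ≠ 0 ∧ |u p| < ε := by
  have hs : (fun p => ramp (3 / 2 - |u p| / ε)) ∈ bddCont X := by
    refine ⟨?_, 1, fun p => by rw [abs_of_nonneg (ramp_nonneg _)]; exact ramp_le_one _⟩
    have := uniformContinuous_ramp.continuous
    fun_prop
  obtain ⟨g, hg⟩ := hA.exists_smul hs f
  obtain ⟨w, hwy, hw⟩ := hu (ε / 2) (half_pos hε)
  refine ⟨g, ?_, fun p hp => ⟨fun h0 => hp (by rw [hg, h0, smul_zero]), ?_⟩⟩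
  · rwa [hT.eq_of_eq (f := w) (k := f) (fun p hp => ?_) hwy]
    rw [hg, ramp_eq_one, RCLike.ofReal_one, one_smul]
    have : |u p| / ε < 1 / 2 := by
      rw [div_lt_iff₀ hε]; linarith [hw p hp]
    linarith
  · by_contra! h
    refine hp ?_
    rw [hg, ramp_eq_zero, RCLike.ofReal_zero, zero_smul]
    have : 1 ≤ |u p| / ε := by rwa [one_le_div hε]
    linarith

/-- A single shell of `(1 + |u|)⁻¹` is a set on which `u` is bounded. This is what excludes infinite
residue values. -/
theorem ShellBounded.exists_bound {T : A ≃ₗ[𝕜] B} {y : Y} (h : ShellBounded T y) (u : C(X, ℝ))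
    {f : A} (hf : (T f).1 y ≠ 0) :
    ∃ (M : ℝ) (g : A), (T g).1 y ≠ 0 ∧ ∀ p, g.1 p ≠ 0 → |u p| ≤ M := by
  have hpos : ∀ x, 0 < 1 + |u x| := fun x => by positivity
  obtain ⟨n, k, hk, hky⟩ := h (fun x => (1 + |u x|)⁻¹)
    (Continuous.inv₀ (by fun_prop) fun x => (hpos x).ne')
    (fun x => ⟨inv_pos.2 (hpos x), inv_le_one_of_one_le₀ (by simp)⟩) f hf
  refine ⟨2 * 2 ^ n, k, hky, fun p hp => ?_⟩
  have : shell n (1 + |u p|)⁻¹ ≠ 0 := fun h0 => hp (by rw [hk, h0]; simp)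
  have h1 := (shell_ne_zero this).1
  rw [← div_eq_mul_inv, lt_div_iff₀ (hpos p)] at h1
  linarith

theorem exists_carrierZero_sub {T : A ≃ₗ[𝕜] B} (hT : PresDisj T)
    (hA : Admissible (bddCont X) A) {y : Y} (h : ShellBounded T y) {f : A} (hf : (T f).1 y ≠ 0)
    (u : C(X, ℝ)) : ∃ c : ℝ, CarrierZero T y (u - ContinuousMap.const X c) := by
  obtain ⟨M, w, hwy, hw⟩ := h.exists_bound u hf
  -- The value of `u` on the carrier is a Dedekind cut: the supremum of the levels `t` such that
  -- everything living on `{u < t}` is killed at `y`.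
  set L : Set ℝ := {t | ∀ g : A, (∀ p, g.1 p ≠ 0 → u p < t) → (T g).1 y = 0} with hL
  have hM : -M ∈ L := fun g hg => hT.eq_zero (f := w) (fun p hp => by
    by_contra hgp
    have h1 := hg p hgp
    have h2 := (abs_le.1 (hw p hp)).1
    linarith) hwy
  have hub : M + 1 ∈ upperBounds L := fun t ht => by
    by_contra! hlt
    exact hwy (ht w fun p hp => by linarith [(abs_le.1 (hw p hp)).2])
  refine ⟨sSup L, fun ε hε => ?_⟩
  have h1 : sSup L + ε ∉ L := fun hmem => by linarith [le_csSup ⟨_, hub⟩ hmem]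
  obtain ⟨t, htL, ht⟩ := exists_lt_of_lt_csSup ⟨_, hM⟩ (sub_lt_self (sSup L) (half_pos hε))
  simp only [hL, Set.mem_ofPred_eq, not_forall] at h1
  obtain ⟨g, hg, hgy⟩ := h1
  -- This cutoff is `1` for `u ≥ t` and `0` for `u ≤ t - ε / 4`; the part of `g` removed lives on
  -- `{u < t}` and is killed because `t ∈ L`.
  have hs : (fun p => ramp ((u p - t) * (2 / ε) + 1)) ∈ bddCont X := by
    refine ⟨?_, 1, fun p => by rw [abs_of_nonneg (ramp_nonneg _)]; exact ramp_le_one _⟩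
    have := uniformContinuous_ramp.continuous
    fun_prop
  obtain ⟨k, hk⟩ := hA.exists_smul hs g
  have hgk : (T (g - k)).1 y = 0 := htL _ fun p hp => by
    by_contra! hle
    refine hp ?_
    change g.1 p - k.1 p = 0
    have : 0 ≤ (u p - t) * (2 / ε) := mul_nonneg (by linarith) (by positivity)
    rw [hk, ramp_eq_one (by linarith)]
    simp
  rw [map_sub] at hgk
  have hgk' : (T g).1 y = (T k).1 y := sub_eq_zero.1 hgk
  refine ⟨k, hgk' ▸ hgy, fun p hp => ?_⟩
  have hgp : g.1 p ≠ 0 := fun h0 => hp (by rw [hk, h0, smul_zero])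
  have hu1 := hg p hgp
  have hu2 : sSup L - ε < u p := by
    by_contra! hle
    refine hp ?_
    have : (u p - t) * (2 / ε) ≤ -(ε / 2) * (2 / ε) := by
      gcongr; linarith
    have h3 : -(ε / 2) * (2 / ε) = -1 := by field_simp
    rw [hk, ramp_eq_zero (by linarith)]
    simp
  change |u p - sSup L| < ε
  rw [abs_lt]
  constructor <;> linarith

/-- Every `u` is congruent to a constant modulo the ideal `I` of `CarrierZero` functions, so `I` is
maximal with residue field `ℝ` and has a common zero `x`. A Urysohn function that is `0` at `x` and
`1` off `U` then lies in `I`, which yields a function living in `U` and not killed at `y`. -/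
theorem IsRealcompact.exists_isSupp [CompletelyRegularSpace X] (hX : IsRealcompact X)
    {T : A ≃ₗ[𝕜] B} (hT : PresDisj T) (hA : Admissible (bddCont X) A) {y : Y}
    (h : ShellBounded T y) (hy : ∃ f, (T f).1 y ≠ 0) : ∃ x, IsSupp T y x := by
  obtain ⟨f₀, hf₀⟩ := hy
  let I : Ideal C(X, ℝ) :=
    { carrier := {u | CarrierZero T y u}
      zero_mem' := fun ε hε => ⟨f₀, hf₀, fun p _ => by simpa using hε⟩
      add_mem' := fun {u v} hu hv ε hε => by
        obtain ⟨f, hf, hfu⟩ := hu (ε / 2) (half_pos hε)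
        obtain ⟨g, hg, hgv⟩ := CarrierZero.inter hT hA hv hf (half_pos hε)
        refine ⟨g, hg, fun p hp => ?_⟩
        have h1 := hfu p (hgv p hp).1
        have h2 := (hgv p hp).2
        have h3 := abs_add_le (u p) (v p)
        change |u p + v p| < ε
        linarith
      smul_mem' := fun c u hu ε hε => by
        obtain ⟨M, f, hf, hfM⟩ := h.exists_bound c hf₀
        have hM : 0 < |M| + 1 := by positivity
        obtain ⟨g, hg, hgu⟩ := CarrierZero.inter hT hA hu hf (div_pos hε hM)
        refine ⟨g, hg, fun p hp => ?_⟩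
        have h1 := hfM p (hgu p hp).1
        have h2 := (hgu p hp).2
        change |c p * u p| < ε
        rw [lt_div_iff₀ hM] at h2
        rw [abs_mul]
        have h3 : |c p| ≤ |M| + 1 := by linarith [le_abs_self M]
        have := mul_le_mul_of_nonneg_right h3 (abs_nonneg (u p))
        linarith }
  have hI : ∀ u, u ∈ I ↔ CarrierZero T y u := fun u => Iff.rfl
  have hval : ∀ u : C(X, ℝ), ∃ c : ℝ, u - ContinuousMap.const X c ∈ I :=
    exists_carrierZero_sub hT hA h hf₀
  have h1I : (1 : C(X, ℝ)) ∉ I := fun h1 => by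
    obtain ⟨f, hf, hf1⟩ := (hI _).1 h1 1 one_pos
    have : f = 0 := by
      ext p
      by_contra hp
      have := hf1 p hp
      simp at this
    exact hf (by simp [this])
  have hmax : I.IsMaximal := by
    rw [Ideal.isMaximal_iff]
    refine ⟨h1I, fun J u hIJ hu huJ => ?_⟩
    obtain ⟨c, hc⟩ := hval u
    have hc0 : c ≠ 0 := by
      rintro rfl
      refine hu ?_
      have : u - ContinuousMap.const X 0 = u := by ext; simp
      rwa [this] at hc
    have hcJ : ContinuousMap.const X c ∈ J := by
      have := J.sub_mem huJ (hIJ hc)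
      rwa [sub_sub_cancel] at this
    have := J.mul_mem_left (ContinuousMap.const X c⁻¹) hcJ
    have e : ContinuousMap.const X c⁻¹ * ContinuousMap.const X c = 1 := by
      ext p; simp [hc0]
    rwa [e] at this
  obtain ⟨x, hx⟩ := hX I hmax fun r => by
    obtain ⟨u, rfl⟩ := Ideal.Quotient.mk_surjective r
    obtain ⟨c, hc⟩ := hval u
    exact ⟨c, ((Ideal.Quotient.eq (I := I)).2 hc).symm⟩
  refine ⟨x, fun U hU => ?_⟩
  obtain ⟨g, hg, hgx, hgU⟩ := CompletelyRegularSpace.completely_regular_isOpen x (interior U)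
    isOpen_interior (mem_interior_iff_mem_nhds.2 hU)
  let u : C(X, ℝ) := ⟨fun p => (g p : ℝ), continuous_subtype_val.comp hg⟩
  obtain ⟨c, hc⟩ := hval u
  have hc0 : c = 0 := by
    have h2 : u x - c = 0 := hx _ hc
    have h3 : u x = 0 := by simp [u, hgx]
    linarith
  obtain ⟨f, hf, hfu⟩ := hc 1 one_pos
  refine ⟨f, hf, fun p hp => ?_⟩
  by_contra hfp
  have h2 := hfu p hfp
  have h3 : g p = 1 := hgU fun h => hp (interior_subset h)
  simp [u, h3, hc0] at h2

theorem locallyFinite_shells {v : X → ℝ} (hv : Continuous v) (h0 : ∀ x, 0 < v x) :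
    LocallyFinite fun n => {x | plateau n (v x) ≠ 0} := fun x => by
  obtain ⟨N, hN⟩ := exists_two_pow_mul_ge (half_pos (h0 x)) 4
  refine ⟨{p | v x / 2 < v p}, continuousAt_const.eventually_lt hv.continuousAt
    (half_lt_self (h0 x)), (Set.finite_lt_nat N).subset ?_⟩
  rintro n ⟨p, hp, hpv⟩
  by_contra! h
  have h1 := (plateau_ne_zero hp).2
  have h2 := hN n (not_lt.1 h)
  have h3 : 2 ^ n * (v x / 2) < 2 ^ n * v p := by
    have : v x / 2 < v p := hpv
    gcongr
  linarith

theorem exists_disjSum_contFun {q : ℕ → contFun 𝕜 X E}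
    (hd : ∀ n m x, (q n).1 x ≠ 0 → (q m).1 x ≠ 0 → n = m)
    (hl : LocallyFinite fun n => Function.support (q n).1) :
    ∃ s : contFun 𝕜 X E, IsDisjSum q s :=
  ⟨⟨⟨fun x => ∑ᶠ n, (q n).1 x, continuous_finsum (fun n => (q n).1.continuous) hl⟩,
    Submodule.mem_top⟩, hd, fun _ => rfl⟩

theorem exists_disjSum_boundedContFun {q : ℕ → boundedContFun 𝕜 X E}
    (hd : ∀ n m x, (q n).1 x ≠ 0 → (q m).1 x ≠ 0 → n = m)
    (hl : LocallyFinite fun n => Function.support (q n).1) {C : ℝ} (hC : ∀ n x, ‖(q n).1 x‖ ≤ C) :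
    ∃ s : boundedContFun 𝕜 X E, IsDisjSum q s := by
  refine ⟨⟨⟨fun x => ∑ᶠ n, (q n).1 x, continuous_finsum (fun n => (q n).1.continuous) hl⟩,
    C, fun x => ?_⟩, hd, fun _ => rfl⟩
  change ‖∑ᶠ n, (q n).1 x‖ ≤ C
  by_cases h : ∃ n, (q n).1 x ≠ 0
  · obtain ⟨n, hn⟩ := h
    rw [finsum_eq_single _ n fun m hm => by by_contra hmx; exact hm (hd m n x hmx hn)]
    exact hC n x
  · push Not at h
    simpa [h] using (norm_nonneg _).trans (hC 0 x)

theorem Admissible.exists_shell_smul (hA : Admissible (bddCont X) A) {v : X → ℝ}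
    (hv : Continuous v) (f : A) :
    ∃ k : ℕ → A, ∀ n x, (k n).1 x = (shell n (v x) : 𝕜) • f.1 x := by
  have : ∀ n, ∃ k : A, ∀ x, k.1 x = (shell n (v x) : 𝕜) • f.1 x := fun n =>
    hA.exists_smul (s := fun x => shell n (v x))
      ⟨(uniformContinuous_shell n).continuous.comp hv, 1, fun x => abs_shell_le _ _⟩ f
  choose k hk using this
  exact ⟨k, hk⟩

theorem support_shell_piece_subset {v : X → ℝ} {f : A} {k : ℕ → A}
    (hk : ∀ n x, (k n).1 x = (shell n (v x) : 𝕜) • f.1 x) (i n : ℕ) :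
    Function.support (if n % 4 = i then k n else 0 : A).1 ⊆ {x | plateau n (v x) ≠ 0} := by
  intro x hx
  rw [Function.mem_support, ite_apply_zero] at hx
  have h1 := (ite_ne_right_iff.1 hx).2
  rw [hk] at h1
  have h2 : shell n (v x) ≠ 0 := fun h0 => h1 (by rw [h0]; simp)
  simp [plateau_eq_one h2]

theorem apply_ite_eq_zero (T : A ≃ₗ[𝕜] B) {k : ℕ → A} {y : Y} (h : ∀ n, (T (k n)).1 y = 0)
    (i n : ℕ) : (T (if n % 4 = i then k n else 0)).1 y = 0 := by
  split_ifs
  · exact h n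
  · simp

/-- Shells of a positive continuous function are locally finite, so the sum with weights `n` is
continuous, and boundedness is not required in `C(X, E)`. -/
theorem shellBounded_contFun [CompletelyRegularSpace X] [CompletelyRegularSpace Y]
    {T : contFun 𝕜 X E ≃ₗ[𝕜] contFun 𝕜 Y F} (hT : PresDisj T) (y : Y) : ShellBounded T y := by
  intro v hv hv1 f hf
  obtain ⟨k, hk⟩ := admissible_contFun.exists_shell_smul hv f
  by_contra! hcon
  have hky : ∀ n, (T (k n)).1 y = 0 := fun n => hcon n (k n) (hk n)
  refine hf (apply_eq_zero_of_shell_pieces T (fun x _ => hv1 x) hk fun i => ?_)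
  have hd := shell_pieces_disjoint hk i
  have hl := (locallyFinite_shells hv fun x => (hv1 x).1).subset
    (support_shell_piece_subset hk i)
  obtain ⟨s, hs⟩ := exists_disjSum_contFun hd hl
  obtain ⟨g, hg⟩ := exists_disjSum_contFun
    (q := fun n => (n : 𝕜) • (if n % 4 = i then k n else 0 : contFun 𝕜 X E))
    (fun n m x hn hm => hd n m x (right_ne_zero_of_smul hn) (right_ne_zero_of_smul hm))
    (hl.subset fun n x hx => right_ne_zero_of_smul (Function.mem_support.1 hx))
  refine ⟨s, hs, hs.apply_eq_zero_of_weights hT admissible_contFun (g := g) (fun n p hp => ?_)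
    (apply_ite_eq_zero T hky i)⟩
  rw [hg.sum_eq]
  refine finsum_eq_single _ n fun m hm => ?_
  by_contra hmp
  exact hm (hd m n p (right_ne_zero_of_smul hmp) hp)

/-- Preimages of a bounded sequence of constants are uniformly bounded on disjoint open sets. -/
theorem PresDisj.exists_bound {S : Set (X → ℝ)} {S' : Set (Y → ℝ)} {T : A ≃ₗ[𝕜] B}
    (hT : PresDisj T) (hA : Admissible S A) (hB : Admissible S' B)
    (hAb : ∀ f : A, ∃ C : ℝ, ∀ x, ‖f.1 x‖ ≤ C) {O : ℕ → Set X} (hO : ∀ n, IsOpen (O n))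
    (hOd : ∀ n m x, x ∈ O n → x ∈ O m → n = m) {d : ℕ → F} {R : ℝ} (hd : ∀ n, ‖d n‖ ≤ R)
    {a : ℕ → A} (ha : ∀ n z, (T (a n)).1 z = d n) :
    ∃ M, ∀ n, ∀ x ∈ O n, ‖(a n).1 x‖ ≤ M := by
  by_contra! hcon
  choose C hC using fun n => hAb (a n)
  -- Each single `a n` is bounded, so a failure of the uniform bound must occur at arbitrarily large
  -- indices.
  have hfreq : ∀ j : ℕ, ∃ᶠ n in atTop, ∃ x ∈ O n, (4 : ℝ) ^ j < ‖(a n).1 x‖ := fun j hev => by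
    obtain ⟨N, hN⟩ := eventually_atTop.1 hev
    obtain ⟨n, x, hx, hn⟩ := hcon (4 ^ j + ∑ n ∈ Finset.range N, |C n|)
    have h0 : 0 ≤ ∑ n ∈ Finset.range N, |C n| := Finset.sum_nonneg fun _ _ => abs_nonneg _
    by_cases hnN : n < N
    · have h1 := Finset.single_le_sum (f := fun n => |C n|) (fun _ _ => abs_nonneg _)
        (Finset.mem_range.2 hnN)
      have h2 : (0 : ℝ) < 4 ^ j := by positivity
      linarith [hC n x, le_abs_self (C n)]
    · exact hN n (not_lt.1 hnN) ⟨x, hx, by linarith⟩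
  obtain ⟨φ, hφ, hφx⟩ := extraction_forall_of_frequently hfreq
  choose x hxO hx using hφx
  choose b hb hb01 hb1 hb0 using fun j => hA.bump (x j) _ ((hO (φ j)).mem_nhds (hxO j))
  choose w hw using fun j => hA.exists_smul (hb j) (a (φ j))
  have hwO : ∀ j p, (w j).1 p ≠ 0 → p ∈ O (φ j) := fun j p hp => by
    by_contra h
    exact hp (by rw [hw, hb0 j p h]; simp)
  have hwd : ∀ j m z, (T (w j)).1 z ≠ 0 → (T (w m)).1 z ≠ 0 → j = m := fun j m z hj hm => by
    by_contra hjm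
    exact hm (hT.eq_zero (f := w j) (fun p hp => by
      by_contra hpm
      exact hjm (hφ.injective (hOd _ _ p (hwO j p hp) (hwO m p hpm)))) hj)
  have hd0 : ∀ j, 0 < ‖d (φ j)‖ := fun j => by
    rw [norm_pos_iff]
    intro h0
    have hz : T (a (φ j)) = 0 := by
      ext z; rw [ha, h0]; rfl
    have hx' := hx j
    rw [(map_eq_zero_iff T T.injective).1 hz] at hx'
    have h4 : (0 : ℝ) < 4 ^ j := by positivity
    have : ‖(0 : A).1 (x j)‖ = 0 := norm_zero
    linarith
  -- The images `T (w j)` need not be uniformly bounded in `j`. They are replaced by multiples `g j`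
  -- of `d (φ j)`: the factor is `1` where `T (w j) = d (φ j)` and `0` where `T (w j) = 0`.
  have hθ : ∀ j, UniformContinuous fun t : ℝ => max 0 (1 - ‖d (φ j)‖⁻¹ * t) := fun j => by
    have h1 : LipschitzWith ‖d (φ j)‖₊⁻¹ fun t : ℝ => 1 - ‖d (φ j)‖⁻¹ * t :=
      LipschitzWith.of_dist_le_mul fun s t => by
        rw [Real.dist_eq, Real.dist_eq, show 1 - ‖d (φ j)‖⁻¹ * s - (1 - ‖d (φ j)‖⁻¹ * t)
          = -(‖d (φ j)‖⁻¹ * (s - t)) by ring, abs_neg, abs_mul, abs_of_pos (inv_pos.2 (hd0 j))]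
        simp
    exact (h1.const_max 0).uniformContinuous
  have hθ1 : ∀ j t, 0 ≤ t → |max 0 (1 - ‖d (φ j)‖⁻¹ * t)| ≤ 1 := fun j t ht => by
    have : 0 ≤ ‖d (φ j)‖⁻¹ * t := mul_nonneg (inv_nonneg.2 (hd0 j).le) ht
    rw [abs_of_nonneg (le_max_left _ _)]
    exact max_le zero_le_one (by linarith)
  choose g hg using fun j => hB.exists_smul
    (hB.comp_norm_mem (T (w j - a (φ j))).1 (T (w j - a (φ j))).2 _ (hθ j) ⟨1, hθ1 j⟩)
    (T (a (φ j)))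
  have hTw : ∀ j z, (T (w j - a (φ j))).1 z = (T (w j)).1 z - d (φ j) := fun j z => by
    rw [map_sub, ← ha (φ j) z]; rfl
  have hgw : ∀ j z, (g j).1 z ≠ 0 → (T (w j)).1 z ≠ 0 := fun j z hz h0 => by
    refine hz ?_
    rw [hg, hTw, h0, zero_sub, norm_neg, inv_mul_cancel₀ (hd0 j).ne', sub_self, max_self]
    simp
  -- The difference `g j - T (a (φ j))` lives where `T (w j - a (φ j))` does, and `w j - a (φ j)`
  -- vanishes near `x j`.
  have hgx : ∀ j, (T.symm (g j)).1 (x j) = (a (φ j)).1 (x j) := fun j => by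
    have h1 : (T.symm (g j - T (a (φ j)))).1 (x j) = 0 := by
      refine hT.symm.eq_zero_of_subset hA (l := T (w j - a (φ j))) (fun z hz h0 => hz ?_) ?_
      · change (g j).1 z - (T (a (φ j))).1 z = 0
        rw [hg, h0]
        simp
      · filter_upwards [hb1 j] with p hp
        rw [T.symm_apply_apply]
        change (w j).1 p - (a (φ j)).1 p = 0
        rw [hw, hp]
        simp
    rw [map_sub, T.symm_apply_apply] at h1
    exact sub_eq_zero.1 h1
  have hG : ∀ j z, (((1 / 2 : ℝ) ^ j : 𝕜) • g j : B).1 z = ((1 / 2 : ℝ) ^ j : 𝕜) • (g j).1 z :=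
    fun _ _ => rfl
  have hnorm : ∀ j : ℕ, ‖((1 / 2 : ℝ) ^ j : 𝕜)‖ = (1 / 2) ^ j := fun j => by
    rw [norm_pow, RCLike.norm_ofReal, abs_of_pos (by norm_num)]
  have hlim : Tendsto (fun j : ℕ => (1 / 2 : ℝ) ^ j * R) atTop (𝓝 0) := by
    simpa using (tendsto_pow_atTop_nhds_zero_of_lt_one (r := (1 / 2 : ℝ))
      (by norm_num) (by norm_num)).mul_const R
  -- The factors `2⁻ʲ` make the sum converge, yet its preimage at `x j` still has norm above `2⁻ʲ 4ʲ
  -- = 2ʲ`.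
  obtain ⟨G, hGs⟩ := hB.exists_disjSum (q := fun j => ((1 / 2 : ℝ) ^ j : 𝕜) • g j)
    (fun j m z hj hm => hwd j m z (hgw j z (right_ne_zero_of_smul hj))
      (hgw m z (right_ne_zero_of_smul hm))) hlim (fun j z => by
      rw [hG, norm_smul, hnorm, hg, norm_smul, RCLike.norm_ofReal, ha]
      gcongr
      calc _ ≤ 1 * R := mul_le_mul (hθ1 j _ (norm_nonneg _)) (hd _) (norm_nonneg _) zero_le_one
        _ = R := one_mul R)
  have hGx : ∀ j, (T.symm G).1 (x j) = ((1 / 2 : ℝ) ^ j : 𝕜) • (a (φ j)).1 (x j) := fun j => by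
    have h1 : (T.symm (((1 / 2 : ℝ) ^ j : 𝕜) • g j)).1 (x j)
        = ((1 / 2 : ℝ) ^ j : 𝕜) • (a (φ j)).1 (x j) := by
      rw [map_smul, ← hgx]; rfl
    rw [← h1]
    refine hT.symm.eq_of_eq (f := ((1 / 2 : ℝ) ^ j : 𝕜) • g j) (fun z hz => hGs.eq hz) ?_
    rw [h1, ← norm_pos_iff, norm_smul, hnorm]
    have h4 : (0 : ℝ) < 4 ^ j := by positivity
    have := h4.trans (hx j)
    positivity
  obtain ⟨K, hK⟩ := hAb (T.symm G)
  obtain ⟨j, hj⟩ := pow_unbounded_of_one_lt K one_lt_two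
  have h1 := hK (x j)
  rw [hGx, norm_smul, hnorm] at h1
  have h2 : (1 / 2 : ℝ) ^ j * 4 ^ j ≤ (1 / 2) ^ j * ‖(a (φ j)).1 (x j)‖ := by
    have := (hx j).le
    gcongr
  rw [← mul_pow] at h2
  norm_num at h2 h1
  linarith

/-- Weights `n` may leave `C_b`. Instead, Riesz's lemma in the infinite-dimensional `F` gives a
bounded sequence `d` of separated vectors; the preimages of these constants are uniformly bounded on
the disjoint shells, so they glue to a bounded function `b`. -/
theorem shellBounded_boundedContFun [CompletelyRegularSpace X] [CompletelyRegularSpace Y]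
    (hF : ¬ FiniteDimensional 𝕜 F)
    {T : boundedContFun 𝕜 X E ≃ₗ[𝕜] boundedContFun 𝕜 Y F} (hT : PresDisj T) (y : Y) :
    ShellBounded T y := by
  intro v hv hv1 f hf
  obtain ⟨k, hk⟩ := admissible_boundedContFun.exists_shell_smul hv f
  by_contra! hcon
  have hky : ∀ n, (T (k n)).1 y = 0 := fun n => hcon n (k n) (hk n)
  refine hf (apply_eq_zero_of_shell_pieces T (fun x _ => hv1 x) hk fun i => ?_)
  have hd := shell_pieces_disjoint hk i
  have hlf := locallyFinite_shells hv fun x => (hv1 x).1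
  obtain ⟨C, hC⟩ := f.2
  obtain ⟨s, hs⟩ := exists_disjSum_boundedContFun (C := C) hd
    (hlf.subset (support_shell_piece_subset hk i)) (fun n x => by
      rw [ite_apply_zero]
      split_ifs
      · rw [hk, norm_smul, RCLike.norm_ofReal]
        calc _ ≤ 1 * C := mul_le_mul (abs_shell_le _ _) (hC x) (norm_nonneg _) zero_le_one
          _ = C := one_mul C
      · exact norm_zero.trans_le ((norm_nonneg _).trans (hC x)))
  have hc : 1 < ‖(2 : 𝕜)‖ := by simp
  obtain ⟨d, hdR, hdsep⟩ := exists_seq_norm_le_one_le_norm_sub' hc (lt_add_one _) hF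
  choose c hc using fun n => (admissible_boundedContFun (𝕜 := 𝕜) (X := Y)).exists_const (d n)
  have ha : ∀ n z, (T (T.symm (c n))).1 z = d n := fun n z => by
    rw [T.apply_symm_apply, hc]
  obtain ⟨M₀, hM₀⟩ := hT.exists_bound admissible_boundedContFun admissible_boundedContFun
    (fun f => f.2) (O := fun n => {x | n % 4 = i ∧ shell n (v x) ≠ 0})
    (fun n => by
      have h1 : IsOpen {x | shell n (v x) ≠ 0} :=
        isOpen_ne_fun ((uniformContinuous_shell n).continuous.comp hv) continuous_const
      exact isOpen_const.inter h1)
    (fun n m x hn hm => eq_of_plateau_ne_zero (hn.1.trans hm.1.symm)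
      (by rw [plateau_eq_one hn.2]; exact one_ne_zero)
      (by rw [plateau_eq_one hm.2]; exact one_ne_zero)) hdR ha
  set a := fun n => T.symm (c n) with ha'
  set M := |M₀| + 1 with hM
  have hMpos : 0 < M := by positivity
  have hmax : ∀ t : ℝ, 0 < max t M := fun t => hMpos.trans_le (le_max_right _ _)
  -- The plateau confines `a n` to a slightly wider shell and the second factor truncates its norm
  -- at `M`; on the shell itself both factors are `1`.
  have hβ : ∀ n, ∃ β : boundedContFun 𝕜 X E, ∀ x, β.1 x
      = ((plateau n (v x) * (M / max ‖(a n).1 x‖ M) : ℝ) : 𝕜) • (a n).1 x := fun n => by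
    refine admissible_boundedContFun.exists_smul
      (s := fun x => plateau n (v x) * (M / max ‖(a n).1 x‖ M)) ⟨?_, 1, fun x => ?_⟩ (a n)
    · refine ((continuous_plateau n).comp hv).mul (continuous_const.div ?_ fun x => (hmax _).ne')
      exact (a n).1.continuous.norm.max continuous_const
    · rw [abs_mul, abs_of_pos (div_pos hMpos (hmax _))]
      exact mul_le_one₀ (abs_plateau_le _ _) (div_pos hMpos (hmax _)).le
        ((div_le_one (hmax _)).2 (le_max_right _ _))
  choose β hβ using hβ
  have hβ0 : ∀ n x, (if n % 4 = i then β n else 0 : boundedContFun 𝕜 X E).1 x ≠ 0 →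
      n % 4 = i ∧ plateau n (v x) ≠ 0 := fun n x hx => by
    rw [ite_apply_zero] at hx
    have h1 := ite_ne_right_iff.1 hx
    refine ⟨h1.1, fun h0 => h1.2 ?_⟩
    rw [hβ, h0]; simp
  obtain ⟨b, hb⟩ := exists_disjSum_boundedContFun (C := M)
    (q := fun n => (if n % 4 = i then β n else 0 : boundedContFun 𝕜 X E))
    (fun n m x hn hm => eq_of_plateau_ne_zero ((hβ0 n x hn).1.trans (hβ0 m x hm).1.symm)
      (hβ0 n x hn).2 (hβ0 m x hm).2)
    (hlf.subset fun n x hx => (hβ0 n x hx).2) (fun n x => by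
      rw [ite_apply_zero]
      split_ifs
      · rw [hβ, norm_smul, RCLike.norm_ofReal, abs_mul, abs_of_pos (div_pos hMpos (hmax _))]
        calc _ ≤ 1 * (M / max ‖(a n).1 x‖ M) * max ‖(a n).1 x‖ M := by
              gcongr
              · exact abs_plateau_le _ _
              · exact le_max_left _ _
          _ = M := by rw [one_mul, div_mul_cancel₀ _ (hmax _).ne']
      · exact norm_zero.trans_le hMpos.le)
  refine ⟨s, hs, hs.apply_eq_zero_of_separated hT admissible_boundedContFun (d := d) (a := a)
    (b := b) (fun n m hnm => hdsep hnm) ha (fun n x hx => ?_) (apply_ite_eq_zero T hky i)⟩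
  rw [ite_apply_zero] at hx
  have h1 := ite_ne_right_iff.1 hx
  have h2 : shell n (v x) ≠ 0 := fun h0 => h1.2 (by rw [hk, h0]; simp)
  by_cases hax : (a n).1 x = 0
  · rw [hax]
    by_contra hne
    obtain ⟨m, hm⟩ := hb.exists_ne hne
    have hmn : m = n := eq_of_plateau_ne_zero ((hβ0 m x hm).1.trans h1.1.symm) (hβ0 m x hm).2
      (by rw [plateau_eq_one h2]; exact one_ne_zero)
    subst hmn
    rw [if_pos h1.1, hβ, hax, smul_zero] at hm
    exact hm rfl
  · have h3 : (β n).1 x = (a n).1 x := by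
      have h4 : ‖(a n).1 x‖ ≤ M := by
        linarith [hM₀ n x ⟨h1.1, h2⟩, le_abs_self M₀]
      rw [hβ, plateau_eq_one h2, max_eq_right h4, div_self hMpos.ne']
      simp
    have h4 : (if n % 4 = i then β n else 0 : boundedContFun 𝕜 X E).1 x = (a n).1 x := by
      rw [if_pos h1.1, h3]
    rw [hb.eq (n := n) (x := x) (by rwa [h4]), h4]

end Realcompact

/-! ### Support points over complete metric spaces, and uniform continuity -/

section UniformlyContinuous

variable {𝕜 : Type*} [RCLike 𝕜] {X Y E F : Type*} [MetricSpace X] [MetricSpace Y]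
  [NormedAddCommGroup E] [NormedSpace 𝕜 E] [NormedAddCommGroup F] [NormedSpace 𝕜 F]

/-- The bounded uniformly continuous real functions. -/
def bddUnifCont (X : Type*) [UniformSpace X] : Set (X → ℝ) :=
  {s | UniformContinuous s ∧ ∃ C, ∀ x, |s x| ≤ C}

theorem exists_unif_separation (P : Set X) {ε : ℝ} (hε : 0 < ε) :
    ∃ s ∈ bddUnifCont X, (∀ x, 0 ≤ s x ∧ s x ≤ 1) ∧
      (∀ x, Metric.infDist x P ≤ ε / 2 → s x = 1) ∧ ∀ x, ε ≤ Metric.infDist x P → s x = 0 := by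
  refine ⟨fun x => ramp (3 / 2 - ε⁻¹ * Metric.infDist x P), ⟨?_, 1, fun p => ?_⟩,
    fun p => ⟨ramp_nonneg _, ramp_le_one _⟩, fun p hp => ramp_eq_one ?_, fun p hp => ramp_eq_zero ?_⟩
  · exact uniformContinuous_ramp.comp (uniformContinuous_const.sub
      (Real.uniformContinuous_const_mul.comp (Metric.uniformContinuous_infDist_pt P)))
  · rw [abs_of_nonneg (ramp_nonneg _)]; exact ramp_le_one _
  · have : ε⁻¹ * Metric.infDist p P ≤ ε⁻¹ * (ε / 2) := by gcongr
    have h2 : ε⁻¹ * (ε / 2) = 1 / 2 := by field_simp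
    linarith
  · have : ε⁻¹ * ε ≤ ε⁻¹ * Metric.infDist p P := by gcongr
    rw [inv_mul_cancel₀ hε.ne'] at this
    linarith

theorem UniformContinuous.ofReal_smul_of_bounded {s : X → ℝ} {f : X → E}
    (hs : UniformContinuous s) (hf : UniformContinuous f) (hs' : ∃ C, ∀ x, |s x| ≤ C)
    (hf' : ∃ C : ℝ, ∀ x, ‖f x‖ ≤ C) : UniformContinuous fun x => (s x : 𝕜) • f x := by
  obtain ⟨C, hC⟩ := hs'
  obtain ⟨D, hD⟩ := hf'
  rw [Metric.uniformContinuous_iff] at *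
  intro ε hε
  have hC' : 0 < |C| + 1 := by positivity
  have hD' : 0 < |D| + 1 := by positivity
  obtain ⟨δ₁, hδ₁, h₁⟩ := hs (ε / 2 / (|D| + 1)) (by positivity)
  obtain ⟨δ₂, hδ₂, h₂⟩ := hf (ε / 2 / (|C| + 1)) (by positivity)
  refine ⟨min δ₁ δ₂, lt_min hδ₁ hδ₂, fun {x y} hxy => ?_⟩
  have e₁ := h₁ (hxy.trans_le (min_le_left _ _))
  have e₂ := h₂ (hxy.trans_le (min_le_right _ _))
  rw [dist_eq_norm] at *
  rw [lt_div_iff₀ hD'] at e₁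
  rw [lt_div_iff₀ hC'] at e₂
  have e : (s x : 𝕜) • f x - (s y : 𝕜) • f y
      = (s x : 𝕜) • (f x - f y) + ((s x - s y : ℝ) : 𝕜) • f y := by
    rw [RCLike.ofReal_sub, smul_sub, sub_smul]; abel
  rw [e]
  refine (norm_add_le _ _).trans_lt ?_
  rw [norm_smul, norm_smul, RCLike.norm_ofReal, RCLike.norm_ofReal]
  have t₁ : |s x| * ‖f x - f y‖ ≤ (|C| + 1) * ‖f x - f y‖ := by
    gcongr; linarith [hC x, le_abs_self C]
  have t₂ : |s x - s y| * ‖f y‖ ≤ |s x - s y| * (|D| + 1) := by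
    gcongr; linarith [hD y, le_abs_self D]
  rw [Real.norm_eq_abs] at e₁
  linarith

theorem admissible_boundedUnifContFun :
    Admissible (bddUnifCont X) (boundedUnifContFun 𝕜 X E) where
  const_mem e := ⟨⟨‖e‖, fun _ => le_rfl⟩, uniformContinuous_const⟩
  smul_mem s hs f hf :=
    have h := hs.1.ofReal_smul_of_bounded (𝕜 := 𝕜) hf.2 hs.2 hf.1
    ⟨⟨_, h.continuous⟩, ⟨exists_bound_smul hs.2 hf.1, h⟩, fun _ => rfl⟩
  comp_norm_mem f hf θ hθ hb := ⟨hθ.comp (uniformContinuous_norm.comp hf.2), by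
    obtain ⟨C, hC⟩ := hb
    exact ⟨C, fun x => hC _ (norm_nonneg _)⟩⟩
  lim_mem f hf g hg :=
    have h := hg.uniformContinuous (Frequently.of_forall fun n => (hf n).2)
    ⟨⟨g, h.continuous⟩, ⟨exists_bound_of_tendstoUniformly (fun n => (hf n).1) hg, h⟩,
      fun _ => rfl⟩
  bump x U hU := by
    obtain ⟨ε, hε, hεU⟩ := Metric.mem_nhds_iff.1 hU
    obtain ⟨s, hs, hs01, hs1, hs0⟩ := exists_unif_separation {x} hε
    refine ⟨s, hs, hs01, ?_, fun p hp => hs0 p ?_⟩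
    · filter_upwards [Metric.ball_mem_nhds x (half_pos hε)] with p hp
      refine hs1 p ?_
      rw [Metric.infDist_singleton]
      exact (Metric.mem_ball.1 hp).le
    · rw [Metric.infDist_singleton]
      by_contra! h
      exact hp (hεU h)

/-- Efremovich's lemma: a sequence of pairs at distance at least `ε` has a subsequence along which
the two sets of points have distance at least `ε / 4`. -/
theorem exists_subseq_separated {p q : ℕ → X} {ε : ℝ} (hε : 0 < ε)
    (h : ∀ n, ε ≤ dist (p n) (q n)) :
    ∃ φ : ℕ → ℕ, Tendsto φ atTop atTop ∧ ∀ i j, ε / 4 ≤ dist (p (φ i)) (q (φ j)) := by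
  by_cases h1 : ∃ a, ∃ᶠ n in atTop, dist (p n) a < ε / 4
  · obtain ⟨a, ha⟩ := h1
    obtain ⟨φ, hφ, hφa⟩ := extraction_of_frequently_atTop ha
    refine ⟨φ, hφ.tendsto_atTop, fun i j => ?_⟩
    have t1 := dist_triangle (p (φ j)) (p (φ i)) (q (φ j))
    have t2 := dist_triangle_right (p (φ j)) (p (φ i)) a
    linarith [h (φ j), hφa i, hφa j]
  by_cases h2 : ∃ a, ∃ᶠ n in atTop, dist (q n) a < ε / 4
  · obtain ⟨a, ha⟩ := h2
    obtain ⟨φ, hφ, hφa⟩ := extraction_of_frequently_atTop ha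
    refine ⟨φ, hφ.tendsto_atTop, fun i j => ?_⟩
    have t1 := dist_triangle (p (φ i)) (q (φ j)) (q (φ i))
    have t2 := dist_triangle_right (q (φ j)) (q (φ i)) a
    linarith [h (φ i), hφa i, hφa j]
  -- Otherwise every point is within `ε / 4` of only finitely many `p n` and `q n`, so indices can
  -- be chosen greedily.
  simp only [not_exists, not_frequently, not_lt] at h1 h2
  have : Std.Symm fun i j : ℕ =>
      i ≠ j ∧ ε / 4 ≤ dist (p i) (q j) ∧ ε / 4 ≤ dist (p j) (q i) :=
    ⟨fun i j hij => ⟨hij.1.symm, hij.2.2, hij.2.1⟩⟩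
  obtain ⟨φ, -, hφ⟩ := exists_seq_of_forall_finset_exists' (fun _ : ℕ => True)
    (fun i j : ℕ => i ≠ j ∧ ε / 4 ≤ dist (p i) (q j) ∧ ε / 4 ≤ dist (p j) (q i)) fun s _ => by
      have : ∀ᶠ m in atTop, ∀ n ∈ s, n ≠ m ∧ ε / 4 ≤ dist (p n) (q m) ∧ ε / 4 ≤ dist (p m) (q n) := by
        rw [Finset.eventually_all]
        intro n _
        filter_upwards [eventually_ne_atTop n, h1 (q n), h2 (p n)] with m hm hp hq
        exact ⟨hm.symm, by rwa [dist_comm], hp⟩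
      obtain ⟨m, hm⟩ := this.exists
      exact ⟨m, trivial, hm⟩
  have hinj : Function.Injective φ := fun i j hij => by
    by_contra hne
    exact (hφ hne).1 hij
  refine ⟨φ, hinj.nat_tendsto_atTop, fun i j => ?_⟩
  by_cases hij : i = j
  · subst hij
    linarith [h (φ i)]
  · exact (hφ hij).2.1

theorem infDist_range_ge {p : ℕ → X} {q : X} {ε : ℝ} (h : ∀ i, ε ≤ dist (p i) q) :
    ε ≤ Metric.infDist q (Set.range p) := by
  rw [Metric.le_infDist (Set.range_nonempty p)]
  rintro _ ⟨i, rfl⟩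
  rw [dist_comm]
  exact h i

variable {S : Set (X → ℝ)} {S' : Set (Y → ℝ)} {A : Submodule 𝕜 C(X, E)} {B : Submodule 𝕜 C(Y, F)}

/-- The points carried by functions whose images live within `1 / (n + 1)` of `y`. -/
def carrier (T : A ≃ₗ[𝕜] B) (y : Y) (n : ℕ) : Set X :=
  {p | ∃ f : A, f.1 p ≠ 0 ∧ ∀ z, (T f).1 z ≠ 0 → dist z y < 1 / (n + 1)}

theorem carrier_anti (T : A ≃ₗ[𝕜] B) (y : Y) {n m : ℕ} (h : n ≤ m) :
    carrier T y m ⊆ carrier T y n := by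
  rintro p ⟨f, hfp, hf⟩
  refine ⟨f, hfp, fun z hz => (hf z hz).trans_le ?_⟩
  gcongr

/-- Localizing the witness `f` near `p` keeps its image nonzero somewhere, and by
`eq_zero_of_subset` only within the closed ball around `y`. At such a point locality makes `T k` and
`T l` agree. -/
theorem exists_near_of_mem_carrier {T : A ≃ₗ[𝕜] B} (hT : PresDisj T) (hA : Admissible S A)
    (hB : Admissible S' B) {y : Y} {n : ℕ} {p : X} (hp : p ∈ carrier T y n) {k l : A}
    (hkl : ∀ᶠ x in 𝓝 p, k.1 x = l.1 x) :
    ∃ z, dist z y ≤ 1 / (n + 1) ∧ (T k).1 z = (T l).1 z := by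
  obtain ⟨f, hfp, hf⟩ := hp
  obtain ⟨b, hb, -, hb1, hb0⟩ := hA.bump p _ hkl
  obtain ⟨m, hm⟩ := hA.exists_smul hb f
  have hmp : m.1 p ≠ 0 := by rw [hm, hb1.self_of_nhds]; simpa using hfp
  obtain ⟨z, hz⟩ : ∃ z, (T m).1 z ≠ 0 := by
    by_contra! h0
    have : T m = 0 := by ext z; exact h0 z
    rw [(map_eq_zero_iff T T.injective).1 this] at hmp
    exact hmp rfl
  refine ⟨z, ?_, hT.eq_of_eq (f := m) (fun x hx => ?_) hz⟩
  · by_contra! hlt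
    refine hz (hT.eq_zero_of_subset hB (l := f) (fun x hx h0 => hx (by rw [hm, h0, smul_zero])) ?_)
    have : ∀ᶠ w in 𝓝 z, 1 / ((n : ℝ) + 1) < dist w y :=
      continuousAt_const.eventually_lt (by fun_prop) hlt
    filter_upwards [this] with w hw
    by_contra hne
    exact absurd (hf w hne) (not_lt.2 hw.le)
  · by_contra hne
    exact hx (by rw [hm, hb0 x hne]; simp)

/-- The points of agreement converge to `y`, so continuity of `T k` and `T l` passes the equality to
`y`. -/
theorem eq_of_eventuallyEq_carrier {T : A ≃ₗ[𝕜] B} (hT : PresDisj T) (hA : Admissible S A)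
    (hB : Admissible S' B) {y : Y} {φ : ℕ → ℕ} (hφ : Tendsto φ atTop atTop) {p : ℕ → X}
    (hp : ∀ j, p j ∈ carrier T y (φ j)) {k l : A}
    (hkl : ∀ j, ∀ᶠ x in 𝓝 (p j), k.1 x = l.1 x) : (T k).1 y = (T l).1 y := by
  choose z hz hzkl using fun j => exists_near_of_mem_carrier hT hA hB (hp j) (hkl j)
  have hlim : Tendsto z atTop (𝓝 y) := by
    rw [tendsto_iff_dist_tendsto_zero]
    exact squeeze_zero (fun _ => dist_nonneg) hz
      (tendsto_one_div_add_atTop_nhds_zero_nat.comp hφ)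
  have h1 := ((T k).1.continuous.tendsto y).comp hlim
  have h2 := ((T l).1.continuous.tendsto y).comp hlim
  refine tendsto_nhds_unique h1 (h2.congr fun j => (hzkl j).symm)

theorem exists_isSupp_of_completeSpace [CompleteSpace X] [Nontrivial F] {T : A ≃ₗ[𝕜] B}
    (hT : PresDisj T) (hA : Admissible (bddUnifCont X) A) (hB : Admissible S' B) (y : Y) :
    ∃ x, IsSupp T y x := by
  obtain ⟨w, hw⟩ := exists_ne (0 : F)
  obtain ⟨c, hc⟩ := hB.exists_const w
  have hg : ∀ n : ℕ, ∃ f : A, (T f).1 y ≠ 0 ∧ ∀ z, (T f).1 z ≠ 0 → dist z y < 1 / (n + 1) := by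
    intro n
    obtain ⟨b, hb, -, hb1, hb0⟩ := hB.bump y _
      (Metric.ball_mem_nhds y (Nat.one_div_pos_of_nat (α := ℝ) (n := n)))
    obtain ⟨m, hm⟩ := hB.exists_smul hb c
    refine ⟨T.symm m, ?_, fun z hz => ?_⟩
    · rw [T.apply_symm_apply, hm, hb1.self_of_nhds, hc]; simpa using hw
    · rw [T.apply_symm_apply] at hz
      by_contra h
      exact hz (by rw [hm, hb0 z h]; simp)
  choose g hgy hg using hg
  -- Otherwise separated sequences `p`, `q` lie in ever smaller carriers. A cutoff `k` of `T.symm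
  -- c`, equal to it near the `p`'s and to `0` near the `q`'s, would satisfy both `T k y = w` and `T
  -- k y = 0`.
  have hsmall : ∀ ε > 0, ∃ n, ∀ p ∈ carrier T y n, ∀ q ∈ carrier T y n, dist p q < ε := by
    intro ε hε
    by_contra! hcon
    choose p hp q hq hpq using hcon
    obtain ⟨φ, hφ, hsep⟩ := exists_subseq_separated hε hpq
    obtain ⟨s, hs, -, hs1, hs0⟩ := exists_unif_separation (Set.range (p ∘ φ))
      (show 0 < ε / 8 by positivity)
    have hcont : Continuous fun x => Metric.infDist x (Set.range (p ∘ φ)) :=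
      Metric.continuous_infDist_pt _
    obtain ⟨k, hk⟩ := hA.exists_smul hs (T.symm c)
    have h1 : (T k).1 y = (T (T.symm c)).1 y :=
      eq_of_eventuallyEq_carrier hT hA hB hφ (fun j => hp (φ j)) fun j => by
        have : ∀ᶠ x in 𝓝 (p (φ j)), Metric.infDist x (Set.range (p ∘ φ)) < ε / 8 / 2 :=
          hcont.continuousAt.eventually_lt continuousAt_const (by
            have hj : p (φ j) ∈ Set.range (p ∘ φ) := ⟨j, rfl⟩
            rw [Metric.infDist_zero_of_mem hj]; positivity)
        filter_upwards [this] with x hx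
        rw [hk, hs1 x hx.le]; simp
    have h2 : (T k).1 y = (T 0).1 y :=
      eq_of_eventuallyEq_carrier hT hA hB hφ (fun j => hq (φ j)) fun j => by
        have : ∀ᶠ x in 𝓝 (q (φ j)), ε / 8 < Metric.infDist x (Set.range (p ∘ φ)) :=
          continuousAt_const.eventually_lt hcont.continuousAt (by
            have := infDist_range_ge (p := p ∘ φ) (q := q (φ j)) fun i => hsep i j
            linarith)
        filter_upwards [this] with x hx
        rw [hk, hs0 x hx.le]; simp
    rw [h1, T.apply_symm_apply, hc, map_zero] at h2
    exact hw h2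
  have hne : ∀ n, ∃ p, p ∈ carrier T y n := fun n => by
    by_contra! h
    have : g n = 0 := by
      ext p
      by_contra hp
      exact h p ⟨g n, hp, hg n⟩
    exact hgy n (by simp [this])
  choose x hx using hne
  have hcau : CauchySeq x := by
    rw [Metric.cauchySeq_iff]
    intro ε hε
    obtain ⟨n, hn⟩ := hsmall ε hε
    exact ⟨n, fun i hi j hj => hn _ (carrier_anti T y hi (hx i)) _ (carrier_anti T y hj (hx j))⟩
  obtain ⟨x₀, hx₀⟩ := cauchySeq_tendsto_of_complete hcau
  refine ⟨x₀, fun U hU => ?_⟩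
  obtain ⟨ε, hε, hεU⟩ := Metric.mem_nhds_iff.1 hU
  obtain ⟨n, hn⟩ := hsmall (ε / 2) (half_pos hε)
  refine ⟨g n, hgy n, fun p hp => ?_⟩
  by_contra hgp
  refine hp (hεU ?_)
  obtain ⟨m, hm, hnm⟩ := ((hx₀.eventually (Metric.ball_mem_nhds x₀ (half_pos hε))).and
    (eventually_ge_atTop n)).exists
  have h1 := hn p ⟨g n, hgp, hg n⟩ _ (carrier_anti T y hnm (hx m))
  have h2 : dist (x m) x₀ < ε / 2 := hm
  have h3 := dist_triangle p (x m) x₀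
  rw [Metric.mem_ball]
  linarith

/-- If `a n`, `b n` approach each other while their images under `h` stay apart, a uniformly
continuous cutoff yields `T k` equal to `w` at the `a`'s and `0` at the `b`'s of a subsequence,
contradicting uniform continuity of `T k`. -/
theorem uniformContinuous_of_weighted_composition [Nontrivial F]
    (T : boundedUnifContFun 𝕜 X E ≃ₗ[𝕜] boundedUnifContFun 𝕜 Y F) (h : Y → X)
    (J : Y → (E ≃ₗ[𝕜] F)) (hJ : ∀ f y, (T f).1 y = J y (f.1 (h y))) : UniformContinuous h := by
  rw [Metric.uniformContinuous_iff]
  intro ε hε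
  by_contra! hcon
  choose a b hab hε' using fun n : ℕ => hcon (1 / (n + 1)) Nat.one_div_pos_of_nat
  obtain ⟨φ, hφ, hsep⟩ := exists_subseq_separated (p := fun n => h (a n)) hε hε'
  obtain ⟨s, hs, -, hs1, hs0⟩ := exists_unif_separation (Set.range fun i => h (a (φ i)))
    (show 0 < ε / 4 by positivity)
  obtain ⟨w, hw⟩ := exists_ne (0 : F)
  obtain ⟨c, hc⟩ := (admissible_boundedUnifContFun (𝕜 := 𝕜) (X := Y)).exists_const w
  obtain ⟨k, hk⟩ := admissible_boundedUnifContFun.exists_smul hs (T.symm c)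
  have h1 : ∀ j, (T k).1 (a (φ j)) = w := fun j => by
    rw [hJ, hk, hs1, RCLike.ofReal_one, one_smul, ← hJ, T.apply_symm_apply, hc]
    have hj : h (a (φ j)) ∈ Set.range fun i => h (a (φ i)) := ⟨j, rfl⟩
    rw [Metric.infDist_zero_of_mem hj]; positivity
  have h2 : ∀ j, (T k).1 (b (φ j)) = 0 := fun j => by
    rw [hJ, hk, hs0, RCLike.ofReal_zero, zero_smul, map_zero]
    exact infDist_range_ge fun i => hsep i j
  obtain ⟨δ, hδ, hδk⟩ := Metric.uniformContinuous_iff.1 (T k).2.2 ‖w‖ (norm_pos_iff.2 hw)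
  obtain ⟨j, hj⟩ := (((tendsto_one_div_add_atTop_nhds_zero_nat (𝕜 := ℝ)).comp hφ).eventually_lt_const
    hδ).exists
  have := hδk ((hab (φ j)).trans hj)
  rw [h1, h2, dist_zero_right] at this
  exact lt_irrefl _ this

end UniformlyContinuous

/-! ### From biseparating maps to linear equivalences, and the theorem -/

section Biseparating

variable {𝕜 : Type*} [RCLike 𝕜] {X Y E F : Type*} [TopologicalSpace X] [TopologicalSpace Y]
  [NormedAddCommGroup E] [NormedSpace 𝕜 E] [NormedAddCommGroup F] [NormedSpace 𝕜 F]
  {A : Submodule 𝕜 C(X, E)} {B : Submodule 𝕜 C(Y, F)}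

theorem cozeroSet_inter_eq_empty {f g : C(X, E)} :
    cozeroSet f ∩ cozeroSet g = ∅ ↔ DisjCoz f g := by
  rw [Set.eq_empty_iff_forall_notMem]
  refine forall_congr' fun x => ?_
  change ¬ (f x ≠ 0 ∧ g x ≠ 0) ↔ _
  tauto

theorem IsBiseparating.exists_presDisj {T : A →ₗ[𝕜] B} (hT : IsBiseparating T) :
    ∃ T' : A ≃ₗ[𝕜] B, (∀ f, T' f = T f) ∧ PresDisj T' := by
  obtain ⟨hb, h1, h2⟩ := hT
  refine ⟨LinearEquiv.ofBijective T hb, fun f => rfl, fun f g => ⟨fun h => ?_, fun h => ?_⟩⟩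
  · exact cozeroSet_inter_eq_empty.1 (h1.2 f g (cozeroSet_inter_eq_empty.2 h))
  · have := cozeroSet_inter_eq_empty.1 (h2.2 (T f) (T g) (cozeroSet_inter_eq_empty.2 h))
    have e : ∀ f, (Equiv.ofBijective T hb).symm (T f) = f :=
      (Equiv.ofBijective T hb).symm_apply_apply
    rwa [e, e] at this

theorem exists_apply_ne_zero [Nontrivial F] {S' : Set (Y → ℝ)} (hB : Admissible S' B)
    (T : A ≃ₗ[𝕜] B) (y : Y) : ∃ f, (T f).1 y ≠ 0 := by
  obtain ⟨w, hw⟩ := exists_ne (0 : F)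
  obtain ⟨c, hc⟩ := hB.exists_const w
  exact ⟨T.symm c, by rwa [T.apply_symm_apply, hc]⟩

end Biseparating

theorem theorem2p4 {𝕜 : Type u₁} [RCLike 𝕜] {X : Type u₂} {Y : Type u₃}
    {E : Type u₄} {F : Type u₅}
    [NormedAddCommGroup E] [NormedSpace 𝕜 E] [NormedAddCommGroup F] [NormedSpace 𝕜 F]
    [Nontrivial E] [Nontrivial F] :
    -- Situation of all continuous functions
    (∀ [TopologicalSpace X] [TopologicalSpace Y] [T35Space X] [T35Space Y],
      IsRealcompact X → IsRealcompact Y →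
      ∀ T : contFun 𝕜 X E →ₗ[𝕜] contFun 𝕜 Y F, IsBiseparating T →
        ∃ (h : Y ≃ₜ X) (J : Y → (E ≃ₗ[𝕜] F)),
          ∀ (f : contFun 𝕜 X E) (y : Y), (T f).1 y = J y (f.1 (h y))) ∧
    -- Situation of bounded continuous functions
    (∀ [TopologicalSpace X] [TopologicalSpace Y] [T35Space X] [T35Space Y],
      IsRealcompact X → IsRealcompact Y →
      ¬ FiniteDimensional 𝕜 E → ¬ FiniteDimensional 𝕜 F →
      ∀ T : boundedContFun 𝕜 X E →ₗ[𝕜] boundedContFun 𝕜 Y F, IsBiseparating T →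
        ∃ (h : Y ≃ₜ X) (J : Y → (E ≃ₗ[𝕜] F)),
          ∀ (f : boundedContFun 𝕜 X E) (y : Y), (T f).1 y = J y (f.1 (h y))) ∧
    -- Situation of bounded uniformly continuous functions
    (∀ [MetricSpace X] [MetricSpace Y] [CompleteSpace X] [CompleteSpace Y],
      ∀ T : boundedUnifContFun 𝕜 X E →ₗ[𝕜] boundedUnifContFun 𝕜 Y F, IsBiseparating T →
        ∃ (h : Y ≃ₜ X) (J : Y → (E ≃ₗ[𝕜] F)),
          (∀ (f : boundedUnifContFun 𝕜 X E) (y : Y), (T f).1 y = J y (f.1 (h y))) ∧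
          UniformContinuous h ∧ UniformContinuous h.symm) := by

  refine ⟨?_, ?_, ?_⟩
  · intro _ _ _ _ hX hY T₀ hT₀
    obtain ⟨T, hTT, hT⟩ := hT₀.exists_presDisj
    obtain ⟨h, J, hJ⟩ := exists_homeomorph hT admissible_contFun admissible_contFun
      (fun y => hX.exists_isSupp hT admissible_contFun (shellBounded_contFun hT y)
        (exists_apply_ne_zero admissible_contFun T y))
      (fun x => hY.exists_isSupp hT.symm admissible_contFun (shellBounded_contFun hT.symm x)
        (exists_apply_ne_zero admissible_contFun T.symm x))
    exact ⟨h, J, fun f y => by rw [← hTT, hJ]⟩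
  · intro _ _ _ _ hX hY hE hF T₀ hT₀
    obtain ⟨T, hTT, hT⟩ := hT₀.exists_presDisj
    obtain ⟨h, J, hJ⟩ := exists_homeomorph hT admissible_boundedContFun admissible_boundedContFun
      (fun y => hX.exists_isSupp hT admissible_boundedContFun
        (shellBounded_boundedContFun hF hT y)
        (exists_apply_ne_zero admissible_boundedContFun T y))
      (fun x => hY.exists_isSupp hT.symm admissible_boundedContFun
        (shellBounded_boundedContFun hE hT.symm x)
        (exists_apply_ne_zero admissible_boundedContFun T.symm x))
    exact ⟨h, J, fun f y => by rw [← hTT, hJ]⟩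
  · intro _ _ _ _ T₀ hT₀
    obtain ⟨T, hTT, hT⟩ := hT₀.exists_presDisj
    obtain ⟨h, J, hJ⟩ := exists_homeomorph hT admissible_boundedUnifContFun
      admissible_boundedUnifContFun
      (exists_isSupp_of_completeSpace hT admissible_boundedUnifContFun
        admissible_boundedUnifContFun)
      (exists_isSupp_of_completeSpace hT.symm admissible_boundedUnifContFun
        admissible_boundedUnifContFun)
    refine ⟨h, J, fun f y => by rw [← hTT, hJ],
      uniformContinuous_of_weighted_composition T h J hJ,
      uniformContinuous_of_weighted_composition T.symm h.symm
        (fun x => (J (h.symm x)).symm) fun g x => ?_⟩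
    rw [LinearEquiv.eq_symm_apply, ← T.apply_symm_apply g, hJ, h.apply_symm_apply,
      T.symm_apply_apply]
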